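/- **Theorem 1 (Separation principle for linear-quadratic stochastic games).** Let $L,N\ge 0$ and consider the $N$-player game $$x_{k+1}=A_kx_k+\sum_{j=1}^N B_k^ju_k^j+a_k+W_kw_k,\qquad y_{k+1}=H_{k+1}x_{k+1}+h_{k+1}+V_{k+1}v_{k+1},\qquad 0\le k<L,$$ where $w_k\sim\mathcal N(0,\Sigma_{w_k})$ and $v_{k+1}\sim\mathcal N(0,\Sigma_{v_{k+1}})$. Given the first measurement $y_0$, the state $x_0$ is $\mathcal N(\hat x_0(y_0),\Sigma_{x_0})$ with $\hat x_0(y_0)$ square integrable; the variables $y_0$, $x_0-\hat x_0(y_0)$, $w_k$, $v_{k}$ are independent. All players share the information $I_k=(y_0,\dots,y_k,u_0^{1:N},\dots,u_{k-1}^{1:N})$, and a strategy of player $i$ consists of measurable maps $u^i_k=\sigma^i_k(I_k)$. A strategy profile is admissible if all resulting controls have finite second moments. Player $i$ minimizes $$J_i=\mathbb E\Big[\tfrac12x_L^T(Q_L^ix_L+2l_L^i)+\sum_{k=0}^{L-1}\Big(\tfrac12x_k^T(Q_k^ix_k+2l_k^i)+\tfrac12\sum_{j=1}^N (u_k^j)^T(R_k^{ij}u_k^j+2r_k^{ij})\Big)\Big].$$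 Let $\hat x_k=\hat x_k(I_k)$ be the Kalman-filter estimate, defined from $\hat x_0(y_0)$, $\Sigma_{x_0}$ by $\hat x^p_{k+1}=A_k\hat x_k+\sum_jB_k^ju_k^j+a_k$, $\Sigma^p_{x_{k+1}}=A_k\Sigma_{x_k}A_k^T+W_k\Sigma_{w_k}W_k^T$, $S_{k+1}=H_{k+1}\Sigma^p_{x_{k+1}}H_{k+1}^T+V_{k+1}\Sigma_{v_{k+1}}V_{k+1}^T$, $K_{k+1}=\Sigma^p_{x_{k+1}}H_{k+1}^TS_{k+1}^{-1}$, $\hat x_{k+1}=\hat x_{k+1}^p+K_{k+1}(y_{k+1}-H_{k+1}\hat x_{k+1}^p-h_{k+1})$, $\Sigma_{x_{k+1}}=(I-K_{k+1}H_{k+1})\Sigma^p_{x_{k+1}}$; assume that $S_1,\dots,S_L$ are invertible. The corresponding deterministic game has dynamics $x_{k+1}=A_kx_k+\sum_jB^j_ku^j_k+a_k$, the same costs without expectation, and strategies $u_k^i=\gamma_k^i(x_k)$. A profile $\gamma$ is a feedback Nash equilibrium of it if, from every time $k<L$ and every state, no player can lower her remaining cost by changing her own strategy. Let $\gamma$ be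 a feedback Nash equilibrium of the deterministic game whose strategies $\gamma^i_k$ are affine in the state. Then: 1. The profile $u^i_k=\gamma^i_k(\hat x_k)$ is admissible and is a Nash equilibrium of the stochastic game: no player can lower $J_i$ by a unilateral change of strategy to one that keeps the profile admissible. 2. It is moreover a feedback Nash equilibrium of the stochastic game: for every $k\le L$ and every admissible profile used before time $k$, following it from time $k$ on gives an admissible profile, and no player can lower $J_i$ by a unilateral change of strategy from time $k$ on that keeps the profile admissible. 3. If $\gamma$ is the only affine feedback Nash equilibrium of the deterministic game (at the times $k<L$), then it gives the only feedback Nash equilibrium of the stochastic game: for every feedback Nash equilibrium $\sigma$ of the stochastic game, and along the play of every admissible profile, $\sigma^i_k(I_k)=\gamma^i_k(\hat x_k)$ almost surely for all $i$ and all $k<L$. -/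

import Mathlib

open MeasureTheory ProbabilityTheory

noncomputable section

/-- Real column vectors of length `n` with the Euclidean norm. -/
abbrev Vec (n : ℕ) : Type := EuclideanSpace ℝ (Fin n)

/-- The matrix-vector product on Euclidean vectors. -/
def mulV {p q : ℕ} (M : Matrix (Fin p) (Fin q) ℝ) (x : Vec q) : Vec p :=
  Matrix.toEuclideanLin M x

/-- The quadratic form with a linear term, `½ xᵀ (M x + 2 c)`. -/
def quadForm {p : ℕ} (M : Matrix (Fin p) (Fin p) ℝ) (c : Vec p) (x : Vec p) : ℝ :=
  (1 / 2) * inner ℝ x (mulV M x + (2 : ℝ) • c)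

/-- The data of an `N`-player linear-quadratic game with horizon `L`: state dimension `n`,
measurement dimension `z`, process-noise dimension `d`, measurement-noise dimension `s`, and
control dimension `m i` for player `i`.

* dynamics `x (k+1) = A k x k + ∑ j, B k j u k j + a k + W k w k`, with `w k ∼ N(0, covW k)`;
* joint measurement `y k = H k x k + h k + V k v k` for `k ≥ 1`, with `v k ∼ N(0, covV k)`;
* initial belief: given `y 0`, the state `x 0` is `N(xhat0 (y 0), cov0)`;
* cost of player `i`: `½ xᵀ (Q x + 2 l)` at the times `0, …, L`, and
  `½ ∑ j, (u j)ᵀ (R i j u j + 2 r i j)` at the times `0, …, L - 1`.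

No definiteness is required of the cost matrices. Only the entries up to the horizon matter. -/
structure LQGame (N n z d s : ℕ) (m : Fin N → ℕ) where
  L : ℕ
  A : ℕ → Matrix (Fin n) (Fin n) ℝ
  B : ℕ → (j : Fin N) → Matrix (Fin n) (Fin (m j)) ℝ
  a : ℕ → Vec n
  W : ℕ → Matrix (Fin n) (Fin d) ℝ
  H : ℕ → Matrix (Fin z) (Fin n) ℝ
  h : ℕ → Vec z
  V : ℕ → Matrix (Fin z) (Fin s) ℝ
  covW : ℕ → Matrix (Fin d) (Fin d) ℝ
  covV : ℕ → Matrix (Fin s) (Fin s) ℝ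
  cov0 : Matrix (Fin n) (Fin n) ℝ
  covW_posSemidef : ∀ k, (covW k).PosSemidef
  covV_posSemidef : ∀ k, (covV k).PosSemidef
  cov0_posSemidef : cov0.PosSemidef
  xhat0 : Vec z → Vec n
  xhat0_measurable : Measurable xhat0
  Q : Fin N → ℕ → Matrix (Fin n) (Fin n) ℝ
  l : Fin N → ℕ → Vec n
  R : Fin N → ℕ → (j : Fin N) → Matrix (Fin (m j)) (Fin (m j)) ℝ
  r : Fin N → ℕ → (j : Fin N) → Vec (m j)

namespace LQGame

variable {N n z d s : ℕ} {m : Fin N → ℕ} (G : LQGame N n z d s m)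

/-- The noise-free transition `A k x + ∑ j, B k j u j + a k`. -/
def drift (k : ℕ) (x : Vec n) (u : (j : Fin N) → Vec (m j)) : Vec n :=
  mulV (G.A k) x + ∑ j, mulV (G.B k j) (u j) + G.a k

/-- The cost of player `i` at a time `k < L`. -/
def stageCost (i : Fin N) (k : ℕ) (x : Vec n) (u : (j : Fin N) → Vec (m j)) : ℝ :=
  quadForm (G.Q i k) (G.l i k) x + ∑ j, quadForm (G.R i k j) (G.r i k j) (u j)

/-- The cost of player `i` at the final time. -/
def terminalCost (i : Fin N) (x : Vec n) : ℝ :=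
  quadForm (G.Q i G.L) (G.l i G.L) x

/-! ### The deterministic game with perfect state feedback -/

/-- A profile of feedback strategies of the deterministic game: `γ i k x` is the control of
player `i` at time `k` in the state `x`. -/
abbrev DetProfile (n : ℕ) (m : Fin N → ℕ) : Type := (i : Fin N) → ℕ → Vec n → Vec (m i)

/-- The cost that player `i` incurs in the deterministic game when `t` stages remain, the time is
`k`, the state is `x`, and all players follow `γ`. -/
def detCost (γ : DetProfile n m) (i : Fin N) : (t k : ℕ) → Vec n → ℝ
  | 0, _, x => G.terminalCost i x
  | t + 1, k, x =>
      G.stageCost i k x (fun j => γ j k x) +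
        detCost γ i t (k + 1) (G.drift k x (fun j => γ j k x))

/-- Feedback Nash equilibrium of the deterministic game: from every time and every state, no
player gains by changing her own feedback strategy. -/
def IsDetFeedbackNash (γ : DetProfile n m) : Prop :=
  ∀ k < G.L, ∀ (x : Vec n) (i : Fin N) (δ : ℕ → Vec n → Vec (m i)),
    G.detCost γ i (G.L - k) k x ≤ G.detCost (Function.update γ i δ) i (G.L - k) k x

/-- The strategies are affine functions of the state at each time of the game. -/
def IsAffineProfile (γ : DetProfile n m) : Prop :=
  ∀ i, ∀ k < G.L, ∃ f : Vec n →ᵃ[ℝ] Vec (m i), ∀ x, γ i k x = f x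

/-! ### The Kalman filter -/

/-- The covariance prediction `A Σ Aᵀ + W covW Wᵀ`. -/
def predictCov (k : ℕ) (S : Matrix (Fin n) (Fin n) ℝ) : Matrix (Fin n) (Fin n) ℝ :=
  G.A k * S * (G.A k).transpose + G.W k * G.covW k * (G.W k).transpose

/-- The innovation covariance `H Σᵖ Hᵀ + V covV Vᵀ` at time `k` for the prior covariance `Σᵖ`. -/
def innovCov (k : ℕ) (Sp : Matrix (Fin n) (Fin n) ℝ) : Matrix (Fin z) (Fin z) ℝ :=
  G.H k * Sp * (G.H k).transpose + G.V k * G.covV k * (G.V k).transpose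

/-- The Kalman gain at time `k` for the prior covariance `Σᵖ`. -/
def gainOf (k : ℕ) (Sp : Matrix (Fin n) (Fin n) ℝ) : Matrix (Fin n) (Fin z) ℝ :=
  Sp * (G.H k).transpose * (G.innovCov k Sp)⁻¹

/-- The posterior covariance at time `k`. -/
def postCov : ℕ → Matrix (Fin n) (Fin n) ℝ
  | 0 => G.cov0
  | k + 1 =>
      (1 - G.gainOf (k + 1) (G.predictCov k (postCov k)) * G.H (k + 1)) *
        G.predictCov k (postCov k)

/-- The Kalman gain used at time `k + 1`. -/
def gain (k : ℕ) : Matrix (Fin n) (Fin z) ℝ :=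
  G.gainOf (k + 1) (G.predictCov k (G.postCov k))

/-- The innovation covariances at the times `1, …, L` are invertible, so that the Kalman gains
are defined. -/
def KalmanWellPosed : Prop :=
  ∀ k < G.L, IsUnit (G.innovCov (k + 1) (G.predictCov k (G.postCov k))).det

/-- The information shared by all players at time `k`: the measurements `y 0, …, y k` and the
controls `u 0, …, u (k-1)` of all players. -/
abbrev History (z : ℕ) (m : Fin N → ℕ) (k : ℕ) : Type :=
  (Fin (k + 1) → Vec z) × (Fin k → (j : Fin N) → Vec (m j))

/-- The Kalman-filter state estimate at time `k`, as a function of the information at time `k`. -/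
def xhat : (k : ℕ) → History z m k → Vec n
  | 0, I => G.xhat0 (I.1 0)
  | k + 1, I =>
      let xp := G.drift k (xhat k (fun t => I.1 t.castSucc, fun t => I.2 t.castSucc))
        (I.2 (Fin.last k))
      xp + mulV (G.gain k) (I.1 (Fin.last (k + 1)) - (mulV (G.H (k + 1)) xp + G.h (k + 1)))

/-! ### The stochastic game -/

/-- A strategy of player `i` in the stochastic game: a control for each time `k` and each
information at time `k`. -/
abbrev Strategy (z : ℕ) (m : Fin N → ℕ) (i : Fin N) : Type :=
  (k : ℕ) → History z m k → Vec (m i)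

/-- A strategy for each player. -/
abbrev Profile (z : ℕ) (m : Fin N → ℕ) : Type := (i : Fin N) → Strategy z m i

/-- Labels of the Gaussian sources of randomness. -/
inductive Source
  | init
  | process (k : ℕ)
  | meas (k : ℕ)

/-- The dimension of each source. -/
def Source.dim (n d s : ℕ) : Source → ℕ
  | .init => n
  | .process _ => d
  | .meas _ => s

/-- The covariance matrix of each source. -/
def sourceCov : (c : Source) → Matrix (Fin (c.dim n d s)) (Fin (c.dim n d s)) ℝ
  | .init => G.cov0
  | .process k => G.covW k
  | .meas k => G.covV k

/-- A realization of the primitive random variables of the game on a sample space: the initial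
measurement `y0`, and the independent centred Gaussian vectors `ξ .init = x 0 - xhat0 (y 0)`,
`ξ (.process k) = w k`, `ξ (.meas k) = v k`, which are also independent of `y0`. -/
structure NoiseModel {Ω : Type*} [MeasurableSpace Ω] (P : Measure Ω) where
  y0 : Ω → Vec z
  ξ : (c : Source) → Ω → Vec (c.dim n d s)
  y0_measurable : Measurable y0
  ξ_measurable : ∀ c, Measurable (ξ c)
  memLp_xhat0 : MemLp (fun ω => G.xhat0 (y0 ω)) 2 P
  law_ξ : ∀ c, P.map (ξ c) = multivariateGaussian 0 (G.sourceCov c)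
  iIndep_ξ : iIndepFun ξ P
  indep_y0 : IndepFun y0 (fun ω c => ξ c ω) P

namespace NoiseModel

variable {G} {Ω : Type*} [MeasurableSpace Ω] {P : Measure Ω} (X : G.NoiseModel P)

/-- The initial estimation error `x 0 - xhat0 (y 0)`. -/
def e0 : Ω → Vec n := X.ξ .init

/-- The process noise. -/
def w (k : ℕ) : Ω → Vec d := X.ξ (.process k)

/-- The measurement noise. -/
def v (k : ℕ) : Ω → Vec s := X.ξ (.meas k)

/-- The state at time `k` together with the information at time `k`, when all players follow
`σ`. -/
def play (σ : Profile z m) (ω : Ω) : (k : ℕ) → Vec n × History z m k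
  | 0 => (G.xhat0 (X.y0 ω) + X.e0 ω, (fun _ => X.y0 ω, fun t => t.elim0))
  | k + 1 =>
      let x := (play σ ω k).1
      let I := (play σ ω k).2
      let u : (j : Fin N) → Vec (m j) := fun j => σ j k I
      let x' := G.drift k x u + mulV (G.W k) (X.w k ω)
      let y' := mulV (G.H (k + 1)) x' + G.h (k + 1) + mulV (G.V (k + 1)) (X.v (k + 1) ω)
      (x', (Fin.snoc (α := fun _ => Vec z) I.1 y',
        Fin.snoc (α := fun _ => (j : Fin N) → Vec (m j)) I.2 u))

/-- The state at time `k`. -/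
def state (σ : Profile z m) (k : ℕ) (ω : Ω) : Vec n := (X.play σ ω k).1

/-- The information available to all players at time `k`. -/
def info (σ : Profile z m) (k : ℕ) (ω : Ω) : History z m k := (X.play σ ω k).2

/-- The control of player `i` at time `k`. -/
def control (σ : Profile z m) (i : Fin N) (k : ℕ) (ω : Ω) : Vec (m i) :=
  σ i k (X.info σ k ω)

/-- The expected cost of player `i`. -/
def cost (σ : Profile z m) (i : Fin N) : ℝ :=
  ∫ ω, (G.terminalCost i (X.state σ G.L ω) +
    ∑ k ∈ Finset.range G.L,
      G.stageCost i k (X.state σ k ω) (fun j => X.control σ j k ω)) ∂P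

/-- Admissible profiles: measurable strategies whose controls have finite second moments. Then all
costs are integrable. -/
def Admissible (σ : Profile z m) : Prop :=
  ∀ i, ∀ k < G.L, Measurable (σ i k) ∧ MemLp (X.control σ i k) 2 P

/-- Nash equilibrium of the stochastic game. -/
def IsNash (σ : Profile z m) : Prop :=
  X.Admissible σ ∧
    ∀ (i : Fin N) (δ : Strategy z m i), X.Admissible (Function.update σ i δ) →
      X.cost σ i ≤ X.cost (Function.update σ i δ) i

/-- The profile that follows `τ` before time `k` and `σ` from time `k` on. -/
def splice (k : ℕ) (τ σ : Profile z m) : Profile z m :=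
  fun i t I => if t < k then τ i t I else σ i t I

/-- Feedback Nash equilibrium of the stochastic game: whatever admissible strategies have been
used before time `k`, it is admissible to follow `σ` from time `k` on, and then no player gains
by changing her own strategy from time `k` on. -/
def IsFeedbackNash (σ : Profile z m) : Prop :=
  ∀ τ : Profile z m, X.Admissible τ → ∀ k ≤ G.L,
    X.Admissible (splice k τ σ) ∧
      ∀ (i : Fin N) (δ : Strategy z m i),
        X.Admissible (splice k τ (Function.update σ i δ)) →
          X.cost (splice k τ σ) i ≤ X.cost (splice k τ (Function.update σ i δ)) i

end NoiseModel

/-- The deterministic feedback strategies `γ` applied to the Kalman-filter estimate. -/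
def atEstimate (γ : DetProfile n m) : Profile z m := fun i k I => γ i k (G.xhat k I)

end LQGame

end

/-! The estimation error of the Kalman filter does not depend on the strategies: controls enter the
state and its estimate through the same drift and cancel in the difference
(`state_eq_and_info_succ`). Error and innovation are jointly Gaussian, and the gain makes the new
error uncorrelated with the innovation (`hasCov_kalman_step`), hence independent of it. By induction
both the error and the next innovation are independent of the shared information, whatever profile
is played (`indepFun_info_err`, `indepFun_info_innov`).

The estimate therefore follows the deterministic dynamics plus a centred independent noise, and
replacing the state by its estimate in a quadratic cost adds only a constant. For affine `γ` the
deterministic value functions are quadratic. Telescoping them along the estimates gives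
`exists_cost_eq_add_sum_gap`: the cost is a constant common to all admissible profiles plus a sum of
gaps, the gap at time `k` being the mean of `detQ - detVal`. A gap vanishes if all play `γ` at that
time and is nonnegative if only the player concerned deviates, which yields both equilibrium claims.

For uniqueness, no convexity is assumed, so it must be shown that the first-order conditions of each
one-stage game determine the controls (`staticRegular_of_unique`). A nonzero solution of the
homogeneous conditions at a time `t` could be added to `γ` at time `t`. This changes the earlier
value functions by affine terms only, which constant shifts of the earlier controls compensate, so a
second affine equilibrium would appear.

Given a feedback equilibrium `σ` of the stochastic game, backward induction makes all later gaps
vanish. If a player moves her control by a multiple of the directional derivative of her remaining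
cost, optimality forces the mean square of that derivative to be zero (`slopeAlong_ae_eq_zero`).
Hence `σ` satisfies the same first-order conditions as `γ` almost surely, and regularity gives
equality (`control_ae_eq`). -/

/-! ### Matrix-vector products -/

/-- The matrix-vector product as a continuous linear map. -/
noncomputable def mulVL {p q : ℕ} (M : Matrix (Fin p) (Fin q) ℝ) : Vec q →L[ℝ] Vec p :=
  LinearMap.toContinuousLinearMap (Matrix.toEuclideanLin M)

theorem mulVL_apply {p q : ℕ} (M : Matrix (Fin p) (Fin q) ℝ) (x : Vec q) :
    mulVL M x = mulV M x := rfl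

theorem mulV_add {p q : ℕ} (M : Matrix (Fin p) (Fin q) ℝ) (x y : Vec q) :
    mulV M (x + y) = mulV M x + mulV M y := map_add (mulVL M) x y

theorem mulV_mulV {p q r : ℕ} (M : Matrix (Fin p) (Fin q) ℝ) (M' : Matrix (Fin q) (Fin r) ℝ)
    (x : Vec r) : mulV M (mulV M' x) = mulV (M * M') x := by
  simp [mulV, Matrix.toLpLin_apply, Matrix.mulVec_mulVec]

theorem add_mulV {p q : ℕ} (M M' : Matrix (Fin p) (Fin q) ℝ) (x : Vec q) :
    mulV (M + M') x = mulV M x + mulV M' x := by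
  simp [mulV]

theorem sub_mulV {p q : ℕ} (M M' : Matrix (Fin p) (Fin q) ℝ) (x : Vec q) :
    mulV (M - M') x = mulV M x - mulV M' x := by
  simp [mulV]

theorem inner_mulV {p q : ℕ} (M : Matrix (Fin p) (Fin q) ℝ) (a : Vec p) (x : Vec q) :
    inner ℝ a (mulV M x) = inner ℝ (mulV M.transpose a) x := by
  have h : mulV M.transpose a = LinearMap.adjoint (Matrix.toEuclideanLin M) a := by
    rw [← Matrix.toEuclideanLin_conjTranspose_eq_adjoint]
    simp [mulV, Matrix.conjTranspose_eq_transpose_of_trivial]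
  rw [h, LinearMap.adjoint_inner_left]
  rfl

@[fun_prop]
theorem continuous_mulV {p q : ℕ} (M : Matrix (Fin p) (Fin q) ℝ) : Continuous (mulV M) :=
  (mulVL M).continuous

@[fun_prop]
theorem measurable_mulV {p q : ℕ} (M : Matrix (Fin p) (Fin q) ℝ) : Measurable (mulV M) :=
  (continuous_mulV M).measurable

/-! ### Independence -/

section Indep

variable {Ω : Type*} [MeasurableSpace Ω] {P : Measure Ω}

/-- The joint law is a triple product measure, and associativity of the product regroups it. -/
theorem IndepFun.prodMk_left_of_right [IsProbabilityMeasure P] {α β δ : Type*} [MeasurableSpace α]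
    [MeasurableSpace β] [MeasurableSpace δ] {X : Ω → α} {Y : Ω → β} {Z : Ω → δ}
    (hX : Measurable X) (hY : Measurable Y) (hZ : Measurable Z)
    (h : IndepFun X (fun ω => (Y ω, Z ω)) P) (h' : IndepFun Y Z P) :
    IndepFun (fun ω => (X ω, Y ω)) Z P := by
  have hXY : IndepFun X Y P := h.comp measurable_id measurable_fst
  rw [indepFun_iff_map_prod_eq_prod_map_map (by fun_prop) (by fun_prop)] at *
  have := P.isProbabilityMeasure_map hX.aemeasurable
  have := P.isProbabilityMeasure_map hY.aemeasurable
  have := P.isProbabilityMeasure_map hZ.aemeasurable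
  rw [h', ← Measure.prodAssoc_prod, ← hXY] at h
  have h2 := congrArg (Measure.map (MeasurableEquiv.prodAssoc.symm)) h
  rw [Measure.map_map (by fun_prop) (by fun_prop), Measure.map_map (by fun_prop) (by fun_prop)]
    at h2
  simpa [Function.comp_def, MeasurableEquiv.prodAssoc] using h2

theorem IndepFun.prodMk_right_of_left [IsProbabilityMeasure P] {α β δ : Type*} [MeasurableSpace α]
    [MeasurableSpace β] [MeasurableSpace δ] {X : Ω → α} {Y : Ω → β} {Z : Ω → δ}
    (hX : Measurable X) (hY : Measurable Y) (hZ : Measurable Z)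
    (h : IndepFun (fun ω => (X ω, Y ω)) Z P) (h' : IndepFun X Y P) :
    IndepFun X (fun ω => (Y ω, Z ω)) P :=
  (IndepFun.prodMk_left_of_right hZ hY hX
    (h.symm.comp measurable_id measurable_swap) h'.symm |>.symm).comp measurable_id measurable_swap

end Indep

/-! ### Cross-covariance matrices -/

section Cov

variable {Ω : Type*} [MeasurableSpace Ω] {P : Measure Ω} {p q r : ℕ}

/-- The cross-covariance of the random vectors `X` and `Y` is given by the matrix `M`. -/
def HasCov (P : Measure Ω) (X : Ω → Vec p) (Y : Ω → Vec q) (M : Matrix (Fin p) (Fin q) ℝ) : Prop :=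
  ∀ (a : Vec p) (b : Vec q),
    cov[fun ω => inner ℝ a (X ω), fun ω => inner ℝ b (Y ω); P] = inner ℝ a (mulV M b)

theorem memLp_inner_const {X : Ω → Vec p} (hX : MemLp X 2 P) (a : Vec p) :
    MemLp (fun ω => (inner ℝ a (X ω) : ℝ)) 2 P :=
  hX.continuousLinearMap_comp (innerSL ℝ a)

theorem HasCov.mulV_left {X : Ω → Vec p} {Y : Ω → Vec q} {M : Matrix (Fin p) (Fin q) ℝ}
    (h : HasCov P X Y M) (C : Matrix (Fin r) (Fin p) ℝ) :
    HasCov P (fun ω => mulV C (X ω)) Y (C * M) := fun a b => by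
  simp only [inner_mulV C, ← mulV_mulV]
  exact h _ _

theorem HasCov.mulV_right {X : Ω → Vec p} {Y : Ω → Vec q} {M : Matrix (Fin p) (Fin q) ℝ}
    (h : HasCov P X Y M) (C : Matrix (Fin r) (Fin q) ℝ) :
    HasCov P X (fun ω => mulV C (Y ω)) (M * C.transpose) := fun a b => by
  simp only [inner_mulV C]
  rw [← mulV_mulV]
  exact h _ _

theorem HasCov.add_left [IsProbabilityMeasure P] {X X' : Ω → Vec p} {Y : Ω → Vec q}
    {M M' : Matrix (Fin p) (Fin q) ℝ}
    (h : HasCov P X Y M) (h' : HasCov P X' Y M') (hX : MemLp X 2 P) (hX' : MemLp X' 2 P)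
    (hY : MemLp Y 2 P) : HasCov P (fun ω => X ω + X' ω) Y (M + M') := fun a b => by
  rw [add_mulV, inner_add_right, ← h, ← h', ← covariance_add_left (memLp_inner_const hX a)
    (memLp_inner_const hX' a) (memLp_inner_const hY b)]
  simp only [inner_add_right]
  rfl

theorem HasCov.sub_left [IsProbabilityMeasure P] {X X' : Ω → Vec p} {Y : Ω → Vec q}
    {M M' : Matrix (Fin p) (Fin q) ℝ}
    (h : HasCov P X Y M) (h' : HasCov P X' Y M') (hX : MemLp X 2 P) (hX' : MemLp X' 2 P)
    (hY : MemLp Y 2 P) : HasCov P (fun ω => X ω - X' ω) Y (M - M') := fun a b => by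
  rw [sub_mulV, inner_sub_right, ← h, ← h', ← covariance_sub_left (memLp_inner_const hX a)
    (memLp_inner_const hX' a) (memLp_inner_const hY b)]
  simp only [inner_sub_right]
  rfl

theorem HasCov.add_right [IsProbabilityMeasure P] {X : Ω → Vec p} {Y Y' : Ω → Vec q}
    {M M' : Matrix (Fin p) (Fin q) ℝ}
    (h : HasCov P X Y M) (h' : HasCov P X Y' M') (hX : MemLp X 2 P) (hY : MemLp Y 2 P)
    (hY' : MemLp Y' 2 P) : HasCov P X (fun ω => Y ω + Y' ω) (M + M') := fun a b => by
  rw [add_mulV, inner_add_right, ← h, ← h', ← covariance_add_right (memLp_inner_const hX a)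
    (memLp_inner_const hY b) (memLp_inner_const hY' b)]
  simp only [inner_add_right]
  rfl

theorem HasCov.sub_right [IsProbabilityMeasure P] {X : Ω → Vec p} {Y Y' : Ω → Vec q}
    {M M' : Matrix (Fin p) (Fin q) ℝ}
    (h : HasCov P X Y M) (h' : HasCov P X Y' M') (hX : MemLp X 2 P) (hY : MemLp Y 2 P)
    (hY' : MemLp Y' 2 P) : HasCov P X (fun ω => Y ω - Y' ω) (M - M') := fun a b => by
  rw [sub_mulV, inner_sub_right, ← h, ← h', ← covariance_sub_right (memLp_inner_const hX a)
    (memLp_inner_const hY b) (memLp_inner_const hY' b)]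
  simp only [inner_sub_right]
  rfl

theorem hasCov_of_indepFun {X : Ω → Vec p} {Y : Ω → Vec q}
    (h : IndepFun X Y P) (hX : MemLp X 2 P) (hY : MemLp Y 2 P) : HasCov P X Y 0 := fun a b => by
  have := IndepFun.covariance_eq_zero (h.comp (φ := fun x => (inner ℝ a x : ℝ))
    (ψ := fun x => (inner ℝ b x : ℝ)) (by fun_prop) (by fun_prop)) (memLp_inner_const hX a)
    (memLp_inner_const hY b)
  exact this.trans (by simp [mulV])

theorem hasCov_of_map_eq [IsProbabilityMeasure P] {X : Ω → Vec p} {S : Matrix (Fin p) (Fin p) ℝ}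
    (hS : S.PosSemidef) (hX : Measurable X) (h : P.map X = multivariateGaussian 0 S) :
    HasCov P X X S := fun a b => by
  have := covarianceBilin_multivariateGaussian (μ := 0) hS a b
  rw [covarianceBilin_apply_eq_cov IsGaussian.memLp_two_id, ← h, covariance_map
    (by fun_prop) (by fun_prop) hX.aemeasurable] at this
  refine this.trans ?_
  simp [mulV, Matrix.toLpLin_apply, PiLp.inner_apply, dotProduct, mul_comm]

end Cov

/-! ### Quadratic functions -/

section Quad

variable {E F : Type*} [NormedAddCommGroup E] [NormedSpace ℝ E] [NormedAddCommGroup F]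
  [NormedSpace ℝ F]

/-- A continuous polynomial function of degree at most two. -/
def IsQuad (f : E → ℝ) : Prop :=
  ∃ (B : E →L[ℝ] E →L[ℝ] ℝ) (l : E →L[ℝ] ℝ) (c : ℝ), ∀ x, f x = B x x + l x + c

/-- A continuous affine function into a normed space. -/
def IsAff (f : E → F) : Prop := ∃ (l : E →L[ℝ] F) (c : F), ∀ x, f x = l x + c

theorem IsAff.continuous {f : E → F} (h : IsAff f) : Continuous f := by
  obtain ⟨l, c, h⟩ := h
  rw [funext h]
  fun_prop

theorem IsAff.const (c : F) : IsAff (fun _ : E => c) := ⟨0, c, by simp⟩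

theorem ContinuousLinearMap.isAff (l : E →L[ℝ] F) : IsAff l := ⟨l, 0, by simp⟩

theorem IsAff.add {f g : E → F} (hf : IsAff f) (hg : IsAff g) : IsAff (fun x => f x + g x) := by
  obtain ⟨l, c, hf⟩ := hf
  obtain ⟨l', c', hg⟩ := hg
  exact ⟨l + l', c + c', fun x => by simp only [hf, hg, _root_.add_apply]; abel⟩

theorem IsAff.comp {G : Type*} [NormedAddCommGroup G] [NormedSpace ℝ G] {f : F → G} {g : E → F}
    (hf : IsAff f) (hg : IsAff g) : IsAff (fun x => f (g x)) := by
  obtain ⟨l, c, hf⟩ := hf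
  obtain ⟨l', c', hg⟩ := hg
  exact ⟨l.comp l', l c' + c, fun x => by simp [hf, hg, add_assoc]⟩

theorem IsAff.prodMk {G : Type*} [NormedAddCommGroup G] [NormedSpace ℝ G] {f : E → F} {g : E → G}
    (hf : IsAff f) (hg : IsAff g) : IsAff (fun x => (f x, g x)) := by
  obtain ⟨l, c, hf⟩ := hf
  obtain ⟨l', c', hg⟩ := hg
  exact ⟨l.prod l', (c, c'), fun x => by simp [hf, hg]⟩

theorem IsAff.pi {ι : Type*} [Fintype ι] {V : ι → Type*} [∀ i, NormedAddCommGroup (V i)]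
    [∀ i, NormedSpace ℝ (V i)] {f : E → (i : ι) → V i} (hf : ∀ i, IsAff fun x => f x i) :
    IsAff f := by
  choose l c h using hf
  exact ⟨ContinuousLinearMap.pi l, c, fun x => funext fun i => by simp [h]⟩

theorem IsAff.sum {ι : Type*} {s : Finset ι} {f : ι → E → F} (hf : ∀ i ∈ s, IsAff (f i)) :
    IsAff (fun x => ∑ i ∈ s, f i x) := by
  classical
  induction s using Finset.induction_on with
  | empty => simpa using IsAff.const (0 : F)
  | insert a s ha ih =>
    simp only [Finset.sum_insert ha]
    exact (hf a (by simp)).add (ih fun i hi => hf i (by simp [hi]))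

theorem AffineMap.isAff [FiniteDimensional ℝ E] (f : E →ᵃ[ℝ] F) : IsAff f :=
  ⟨LinearMap.toContinuousLinearMap f.linear, f 0, fun x => by
    have := f.map_vadd 0 x
    simpa using this⟩

theorem IsAff.isQuad {f : E → ℝ} (hf : IsAff f) : IsQuad f := by
  obtain ⟨l, c, hf⟩ := hf
  exact ⟨0, l, c, fun x => by simp [hf]⟩

theorem IsQuad.add {f g : E → ℝ} (hf : IsQuad f) (hg : IsQuad g) :
    IsQuad (fun x => f x + g x) := by
  obtain ⟨B, l, c, hf⟩ := hf
  obtain ⟨B', l', c', hg⟩ := hg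
  exact ⟨B + B', l + l', c + c', fun x => by
    simp only [hf, hg, _root_.add_apply]; ring⟩

theorem IsQuad.sum {ι : Type*} {s : Finset ι} {f : ι → E → ℝ} (hf : ∀ i ∈ s, IsQuad (f i)) :
    IsQuad (fun x => ∑ i ∈ s, f i x) := by
  classical
  induction s using Finset.induction_on with
  | empty => simpa using (IsAff.const (0 : ℝ)).isQuad
  | insert a s ha ih =>
    simp only [Finset.sum_insert ha]
    exact (hf a (by simp)).add (ih fun i hi => hf i (by simp [hi]))

theorem IsQuad.comp {f : F → ℝ} {g : E → F} (hf : IsQuad f) (hg : IsAff g) :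
    IsQuad (fun x => f (g x)) := by
  obtain ⟨B, l, c, hf⟩ := hf
  obtain ⟨l', c', hg⟩ := hg
  refine ⟨B.bilinearComp l' l', (B c').comp l' + (B.flip c').comp l' + l.comp l',
    B c' c' + l c' + c, fun x => ?_⟩
  simp only [hf, hg, map_add, _root_.add_apply, ContinuousLinearMap.bilinearComp_apply,
    ContinuousLinearMap.comp_apply, ContinuousLinearMap.flip_apply]
  ring

theorem isQuad_quadForm {p : ℕ} (M : Matrix (Fin p) (Fin p) ℝ) (c : Vec p) :
    IsQuad (quadForm M c) := by
  refine ⟨(1 / 2 : ℝ) • (innerSL ℝ).bilinearComp (.id ℝ _) (mulVL M), innerSL ℝ c, 0,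
    fun x => ?_⟩
  simp [quadForm, inner_add_right, inner_smul_right, mulVL_apply, real_inner_comm c x,
    ContinuousLinearMap.bilinearComp_apply]
  ring

/-- The polarization of a quadratic function, twice its symmetric bilinear form. -/
def polarForm (f : E → ℝ) (x y : E) : ℝ := f (x + y) - f x - f y + f 0

/-- `B` is not assumed symmetric; the symmetrization is determined by `f` alone. -/
theorem polarForm_eq {f : E → ℝ} {B : E →L[ℝ] E →L[ℝ] ℝ} {l : E →L[ℝ] ℝ} {c : ℝ}
    (h : ∀ x, f x = B x x + l x + c) (x y : E) : polarForm f x y = B x y + B y x := by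
  simp only [polarForm, h, map_add, _root_.add_apply, map_zero]
  ring

theorem eq_zero_of_forall_quadratic_nonneg {D b : ℝ} (h : ∀ s : ℝ, 0 ≤ s * D + s ^ 2 * b) :
    D = 0 ∧ 0 ≤ b := by
  have hb : 0 ≤ b := by
    have h1 := h 1
    have h2 := h (-1)
    linarith
  refine ⟨?_, hb⟩
  by_contra hD
  -- The denominator `b + 1` is positive even when `b = 0`, and this choice makes the expression
  -- `-(D / (b + 1))²`.
  have h1 := h (-D / (b + 1))
  have h2 : -D / (b + 1) * D + (-D / (b + 1)) ^ 2 * b = -(D ^ 2 / (b + 1) ^ 2) := by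
    field_simp
    ring
  have h3 : 0 < D ^ 2 / (b + 1) ^ 2 := by positivity
  linarith

variable {Ω : Type*} [MeasurableSpace Ω] {P : Measure Ω}

theorem MemLp.prodMk' {X : Ω → E} {Y : Ω → F} (hX : MemLp X 2 P) (hY : MemLp Y 2 P) :
    MemLp (fun ω => (X ω, Y ω)) 2 P := by
  have h1 := hX.continuousLinearMap_comp (ContinuousLinearMap.inl ℝ E F)
  have h2 := hY.continuousLinearMap_comp (ContinuousLinearMap.inr ℝ E F)
  simpa [Pi.add_def] using h1.add h2

theorem IsAff.memLp [IsFiniteMeasure P] {f : E → F} (hf : IsAff f) {X : Ω → E}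
    (hX : MemLp X 2 P) : MemLp (fun ω => f (X ω)) 2 P := by
  obtain ⟨l, c, hf⟩ := hf
  simp only [hf]
  exact (hX.continuousLinearMap_comp l).add (memLp_const c)

theorem integrable_bilin (B : E →L[ℝ] F →L[ℝ] ℝ) {X : Ω → E} {Y : Ω → F} (hX : MemLp X 2 P)
    (hY : MemLp Y 2 P) : Integrable (fun ω => B (X ω) (Y ω)) P :=
  memLp_one_iff_integrable.1 (ContinuousLinearMap.memLp_of_bilin 1 B hX hY)

theorem IsQuad.integrable [IsFiniteMeasure P] {f : E → ℝ} (hf : IsQuad f) {X : Ω → E}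
    (hX : MemLp X 2 P) : Integrable (fun ω => f (X ω)) P := by
  obtain ⟨B, l, c, hf⟩ := hf
  simp only [hf]
  exact ((integrable_bilin B hX hX).add
    ((hX.continuousLinearMap_comp l).integrable (by norm_num))).add (integrable_const c)

/-- An independent centred perturbation shifts the expectation of a quadratic function by a
quantity that depends only on the perturbation. -/
theorem IsQuad.integral_add [IsProbabilityMeasure P] [CompleteSpace E] [MeasurableSpace E]
    [BorelSpace E] {f : E → ℝ} (hf : IsQuad f) {X Y : Ω → E} (hX : MemLp X 2 P) (hY : MemLp Y 2 P)
    (hXY : IndepFun X Y P) (hY0 : ∫ ω, Y ω ∂P = 0) :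
    ∫ ω, f (X ω + Y ω) ∂P = ∫ ω, f (X ω) ∂P + ∫ ω, (f (Y ω) - f 0) ∂P := by
  have hfX := hf.integrable hX
  have hfY : Integrable (fun ω => f (Y ω) - f 0) P :=
    (hf.integrable hY).sub (integrable_const (f 0))
  have hfXY : Integrable (fun ω => f (X ω) + (f (Y ω) - f 0)) P := hfX.add hfY
  obtain ⟨B, l, c, h⟩ := hf
  have hXi := hX.integrable (by norm_num)
  have hYi := hY.integrable (by norm_num)
  have hB : Integrable (fun ω => B (X ω) (Y ω) + B.flip (X ω) (Y ω)) P :=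
    (integrable_bilin B hX hY).add (integrable_bilin B.flip hX hY)
  -- The cross terms have zero mean because `Y` is centred and independent of `X`.
  have h1 : ∫ ω, (B (X ω) (Y ω) + B.flip (X ω) (Y ω)) ∂P = 0 := by
    rw [MeasureTheory.integral_add (integrable_bilin B hX hY) (integrable_bilin B.flip hX hY),
      hXY.integral_bilin hXi hYi B, hXY.integral_bilin hXi hYi B.flip, hY0]
    simp
  have h2 : ∀ ω, f (X ω + Y ω) =
      f (X ω) + (f (Y ω) - f 0) + (B (X ω) (Y ω) + B.flip (X ω) (Y ω)) := fun ω => by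
    simp only [h, map_add, _root_.add_apply, map_zero,
      ContinuousLinearMap.flip_apply]
    ring
  simp only [h2]
  rw [MeasureTheory.integral_add hfXY hB, h1, MeasureTheory.integral_add hfX hfY, add_zero]

end Quad

namespace LQGame

variable {N n z d s : ℕ} {m : Fin N → ℕ} (G : LQGame N n z d s m)

/-! ### Propagation of the information and of the estimate -/

theorem drift_add (k : ℕ) (x e : Vec n) (u : (j : Fin N) → Vec (m j)) :
    G.drift k (x + e) u = G.drift k x u + mulV (G.A k) e := by
  simp only [drift, mulV_add]; abel

theorem isAff_drift (k : ℕ) :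
    IsAff (fun p : Vec n × ((j : Fin N) → Vec (m j)) => G.drift k p.1 p.2) := by
  have h1 : IsAff (fun p : Vec n × ((j : Fin N) → Vec (m j)) => p.1) :=
    (ContinuousLinearMap.fst ℝ (Vec n) ((j : Fin N) → Vec (m j))).isAff
  have h2 : ∀ j, IsAff (fun p : Vec n × ((j : Fin N) → Vec (m j)) => p.2 j) := fun j =>
    ((ContinuousLinearMap.proj (R := ℝ) (φ := fun j => Vec (m j)) j).comp
      (ContinuousLinearMap.snd ℝ (Vec n) ((j : Fin N) → Vec (m j)))).isAff
  exact (((mulVL (G.A k)).isAff.comp h1).add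
    (IsAff.sum fun j _ => (mulVL (G.B k j)).isAff.comp (h2 j))).add (IsAff.const _)

theorem measurable_drift (k : ℕ) :
    Measurable (fun p : Vec n × ((j : Fin N) → Vec (m j)) => G.drift k p.1 p.2) := by
  unfold drift
  fun_prop

/-- The information at time `k + 1`, restricted to time `k`. -/
def prevInfo (k : ℕ) (I : History z m (k + 1)) : History z m k :=
  (fun t => I.1 t.castSucc, fun t => I.2 t.castSucc)

theorem measurable_prevInfo (k : ℕ) : Measurable (prevInfo (z := z) (m := m) k) := by
  refine Measurable.prodMk ?_ ?_
  · exact measurable_pi_lambda _ fun t => (measurable_pi_apply _).comp measurable_fst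
  · exact measurable_pi_lambda _ fun t => (measurable_pi_apply _).comp measurable_snd

theorem measurable_xhat (k : ℕ) : Measurable (G.xhat k) := by
  induction k with
  | zero => exact G.xhat0_measurable.comp (by fun_prop)
  | succ k ih =>
    have h0 : Measurable (fun I : History z m (k + 1) => I.2 (Fin.last k)) :=
      (measurable_pi_apply (Fin.last k)).comp measurable_snd
    have h2 : Measurable (fun I : History z m (k + 1) => I.1 (Fin.last (k + 1))) :=
      (measurable_pi_apply (Fin.last (k + 1))).comp measurable_fst
    have h1 := (G.measurable_drift k).comp ((ih.comp (measurable_prevInfo k)).prodMk h0)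
    have h3 : Measurable (fun p : Vec n × Vec z => p.1 +
        mulV (G.gain k) (p.2 - (mulV (G.H (k + 1)) p.1 + G.h (k + 1)))) := by fun_prop
    exact (h3.comp (h1.prodMk h2) :)

/-- The information at time `k + 1`, given the information and the innovation. -/
noncomputable def nextInfo (σ : Profile z m) (k : ℕ) (p : History z m k × Vec z) :
    History z m (k + 1) :=
  (Fin.snoc (α := fun _ => Vec z) p.1.1
      (mulV (G.H (k + 1)) (G.drift k (G.xhat k p.1) (fun j => σ j k p.1)) + G.h (k + 1) + p.2),
    Fin.snoc (α := fun _ => (j : Fin N) → Vec (m j)) p.1.2 (fun j => σ j k p.1))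

theorem measurable_snoc {α : Type*} [MeasurableSpace α] (k : ℕ) :
    Measurable (fun p : (Fin k → α) × α => Fin.snoc (α := fun _ => α) p.1 p.2) := by
  refine measurable_pi_lambda _ fun i => ?_
  refine Fin.lastCases ?_ (fun j => ?_) i
  · simpa using measurable_snd
  · simp only [Fin.snoc_castSucc]
    fun_prop

theorem measurable_nextInfo (σ : Profile z m) (k : ℕ) (hσ : ∀ i, Measurable (σ i k)) :
    Measurable (G.nextInfo σ k) := by
  have h1 : Measurable (fun p : History z m k × Vec z => fun j => σ j k p.1) :=
    measurable_pi_lambda _ fun j => (hσ j).comp measurable_fst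
  have h2 := (G.measurable_drift k).comp (((G.measurable_xhat k).comp measurable_fst).prodMk h1)
  have h3 : Measurable (fun q : Vec n × Vec z => mulV (G.H (k + 1)) q.1 + G.h (k + 1) + q.2) := by
    fun_prop
  have h4 := h3.comp (h2.prodMk measurable_snd)
  have h5 : Measurable (fun p : History z m k × Vec z => p.1.1) :=
    measurable_fst.comp measurable_fst
  have h6 : Measurable (fun p : History z m k × Vec z => p.1.2) :=
    measurable_snd.comp measurable_fst
  have h7 := (measurable_snoc (k + 1)).comp (h5.prodMk h4)
  have h8 := (measurable_snoc k).comp (h6.prodMk h1)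
  exact (h7.prodMk h8 :)

theorem xhat_nextInfo (σ : Profile z m) (k : ℕ) (I : History z m k) (ν : Vec z) :
    G.xhat (k + 1) (G.nextInfo σ k (I, ν)) =
      G.drift k (G.xhat k I) (fun j => σ j k I) + mulV (G.gain k) ν := by
  have h : ∀ a b : Vec z, a + b + ν - (a + b) = ν := fun a b => by abel
  simp [xhat, nextInfo, Fin.snoc_castSucc, Fin.snoc_last, h]

namespace NoiseModel

variable {G} {Ω : Type*} [MeasurableSpace Ω] {P : Measure Ω} (X : G.NoiseModel P)

/-- The prediction error at time `k + 1` for the estimation error `e` at time `k`. -/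
noncomputable def priorErr (k : ℕ) (e : Ω → Vec n) (ω : Ω) : Vec n :=
  mulV (G.A k) (e ω) + mulV (G.W k) (X.w k ω)

/-- The innovation at time `k + 1` for the estimation error `e` at time `k`. -/
noncomputable def innovOf (k : ℕ) (e : Ω → Vec n) (ω : Ω) : Vec z :=
  mulV (G.H (k + 1)) (X.priorErr k e ω) + mulV (G.V (k + 1)) (X.v (k + 1) ω)

/-- The estimation error of the Kalman filter, which does not depend on the strategies. -/
noncomputable def err : ℕ → Ω → Vec n
  | 0 => X.e0
  | k + 1 => fun ω => X.priorErr k (err k) ω - mulV (G.gain k) (X.innovOf k (err k) ω)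

/-- The innovation of the Kalman filter at time `k + 1`. -/
noncomputable def innov (k : ℕ) : Ω → Vec z := X.innovOf k (X.err k)

/-- The drift is additive in the state, so the part of the prediction error due to the controls
cancels. The two claims are coupled: the measurement is prediction plus innovation only once the
state is known to be estimate plus error, and this form of the measurement carries the decomposition
to the next time. -/
theorem state_eq_and_info_succ (σ : Profile z m) (k : ℕ) (ω : Ω) :
    X.state σ k ω = G.xhat k (X.info σ k ω) + X.err k ω ∧
      X.info σ (k + 1) ω = G.nextInfo σ k (X.info σ k ω, X.innov k ω) := by
  have step : ∀ k, X.state σ k ω = G.xhat k (X.info σ k ω) + X.err k ω →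
      X.info σ (k + 1) ω = G.nextInfo σ k (X.info σ k ω, X.innov k ω) := fun k hk => by
    have h1 : G.drift k (X.play σ ω k).1 (fun j => σ j k (X.play σ ω k).2) =
        G.drift k (G.xhat k (X.info σ k ω)) (fun j => σ j k (X.info σ k ω)) +
          mulV (G.A k) (X.err k ω) := by
      rw [← drift_add, ← hk]; rfl
    simp only [info, play, nextInfo, h1]
    refine Prod.ext ?_ rfl
    refine congrArg (Fin.snoc (α := fun _ => Vec z) (X.play σ ω k).2.1) ?_
    simp only [innov, innovOf, priorErr, mulV_add]
    abel
  have main : X.state σ k ω = G.xhat k (X.info σ k ω) + X.err k ω := by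
    induction k with
    | zero => rfl
    | succ k ih =>
      rw [step k ih, xhat_nextInfo]
      have h1 : X.state σ (k + 1) ω =
          G.drift k (X.state σ k ω) (fun j => σ j k (X.info σ k ω)) + mulV (G.W k) (X.w k ω) := rfl
      rw [h1, ih, drift_add]
      simp only [innov, err, priorErr]
      abel
  exact ⟨main, step k main⟩

theorem state_eq (σ : Profile z m) (k : ℕ) (ω : Ω) :
    X.state σ k ω = G.xhat k (X.info σ k ω) + X.err k ω :=
  (X.state_eq_and_info_succ σ k ω).1

theorem info_succ (σ : Profile z m) (k : ℕ) (ω : Ω) :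
    X.info σ (k + 1) ω = G.nextInfo σ k (X.info σ k ω, X.innov k ω) :=
  (X.state_eq_and_info_succ σ k ω).2

theorem xhat_info_succ (σ : Profile z m) (k : ℕ) (ω : Ω) :
    G.xhat (k + 1) (X.info σ (k + 1) ω) =
      G.drift k (G.xhat k (X.info σ k ω)) (fun j => X.control σ j k ω) +
        mulV (G.gain k) (X.innov k ω) := by
  rw [info_succ, xhat_nextInfo]
  rfl

/-! ### Measurability with respect to the past -/

theorem measurable_w (k : ℕ) : Measurable (X.w k) := X.ξ_measurable _

theorem measurable_v (k : ℕ) : Measurable (X.v k) := X.ξ_measurable _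

/-- The σ-algebra `mΩ'` is arbitrary so that the result serves both the ambient one and `past`. -/
theorem measurable_innovOf {Ω : Type*} {mΩ' : MeasurableSpace Ω} [MeasurableSpace Ω] {P : Measure Ω}
    (X : G.NoiseModel P) (k : ℕ) {e : Ω → Vec n}
    (he : Measurable[mΩ'] e) (hw : Measurable[mΩ'] (X.w k)) (hv : Measurable[mΩ'] (X.v (k + 1))) :
    Measurable[mΩ'] (X.innovOf k e) := by
  have h : Measurable (fun p : Vec n × Vec d × Vec s =>
      mulV (G.H (k + 1)) (mulV (G.A k) p.1 + mulV (G.W k) p.2.1) +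
        mulV (G.V (k + 1)) p.2.2) := by fun_prop
  exact (h.comp (he.prodMk (hw.prodMk hv)) :)

theorem measurable_err_succ {Ω : Type*} {mΩ' : MeasurableSpace Ω} [MeasurableSpace Ω]
    {P : Measure Ω} (X : G.NoiseModel P) (k : ℕ) (he : Measurable[mΩ'] (X.err k))
    (hw : Measurable[mΩ'] (X.w k)) (hv : Measurable[mΩ'] (X.v (k + 1))) :
    Measurable[mΩ'] (X.err (k + 1)) := by
  have h : Measurable (fun p : (Vec n × Vec d) × Vec z =>
      mulV (G.A k) p.1.1 + mulV (G.W k) p.1.2 - mulV (G.gain k) p.2) := by fun_prop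
  exact (h.comp ((he.prodMk hw).prodMk (X.measurable_innovOf k he hw hv)) :)

theorem measurable_err (k : ℕ) : Measurable (X.err k) := by
  induction k with
  | zero => exact X.ξ_measurable _
  | succ k ih => exact X.measurable_err_succ k ih (X.measurable_w k) (X.measurable_v _)

theorem measurable_innov (k : ℕ) : Measurable (X.innov k) :=
  X.measurable_innovOf k (X.measurable_err k) (X.measurable_w k) (X.measurable_v _)

/-- The sources of randomness that determine the information at time `k`. -/
def pastSources (k : ℕ) : Set Source :=
  {c | match c with
    | .init => True
    | .process j => j < k
    | .meas j => j ≤ k}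

/-- The events determined by the first measurement and the noise up to time `k`. -/
@[reducible]
def past (k : ℕ) : MeasurableSpace Ω :=
  MeasurableSpace.comap X.y0 inferInstance ⊔
    ⨆ c ∈ pastSources k, MeasurableSpace.comap (X.ξ c) inferInstance

theorem measurable_past {k : ℕ} {c : Source} (hc : c ∈ pastSources k) :
    Measurable[X.past k] (X.ξ c) := by
  rw [measurable_iff_comap_le]
  exact le_sup_of_le_right
    (le_iSup₂ (f := fun c _ => MeasurableSpace.comap (X.ξ c) inferInstance) c hc)

theorem past_le_succ (k : ℕ) : X.past k ≤ X.past (k + 1) := by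
  refine sup_le_sup le_rfl (biSup_mono fun c hc => ?_)
  cases c with
  | init => trivial
  | process j => exact Nat.lt_succ_of_lt hc
  | meas j => exact Nat.le_succ_of_le hc

/-- Adaptedness: it makes the information and the error jointly independent of the noise that enters
next. -/
theorem measurable_past_info_err (σ : Profile z m) (k : ℕ)
    (hσ : ∀ i, ∀ t < k, Measurable (σ i t)) :
    Measurable[X.past k] (fun ω => (X.info σ k ω, X.err k ω)) := by
  induction k with
  | zero =>
    have h0 : Measurable[X.past 0] X.y0 := by
      rw [measurable_iff_comap_le]
      exact le_sup_left
    have h1 : Measurable (fun y : Vec z => ((fun _ => y, fun t => t.elim0) : History z m 0)) := by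
      refine Measurable.prodMk (by fun_prop) (measurable_pi_lambda _ fun t => t.elim0)
    exact (h1.comp h0).prodMk (X.measurable_past (c := .init) trivial)
  | succ k ih =>
    have ih := (ih fun i t ht => hσ i t (by omega)).mono (X.past_le_succ k) le_rfl
    have hw : Measurable[X.past (k + 1)] (X.w k) :=
      X.measurable_past (c := .process k) (Nat.lt_succ_self k)
    have hv : Measurable[X.past (k + 1)] (X.v (k + 1)) :=
      X.measurable_past (c := .meas (k + 1)) (le_refl (k + 1))
    have hI : Measurable[X.past (k + 1)] (X.info σ k) := measurable_fst.comp ih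
    have he : Measurable[X.past (k + 1)] (X.err k) := measurable_snd.comp ih
    refine Measurable.prodMk ?_ (X.measurable_err_succ k he hw hv)
    have h1 : X.info σ (k + 1) = fun ω => G.nextInfo σ k (X.info σ k ω, X.innov k ω) :=
      funext fun ω => X.info_succ σ k ω
    rw [h1]
    exact ((G.measurable_nextInfo σ k fun i => hσ i k (by omega)).comp
      (hI.prodMk (X.measurable_innovOf k he hw hv)) :)

theorem measurable_info (σ : Profile z m) (k : ℕ) (hσ : ∀ i, ∀ t < k, Measurable (σ i t)) :
    Measurable (X.info σ k) := by
  refine measurable_fst.comp ((X.measurable_past_info_err σ k hσ).mono ?_ le_rfl)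
  exact sup_le X.y0_measurable.comap_le (iSup₂_le fun c _ => (X.ξ_measurable c).comap_le)

end NoiseModel
end LQGame

/-! ### Tools for one filter step: means, independent σ-algebras, the Riccati recursion. -/

theorem mulV_zero {p q : ℕ} (M : Matrix (Fin p) (Fin q) ℝ) : mulV M 0 = 0 := map_zero (mulVL M)

theorem integral_mulV {Ω : Type*} [MeasurableSpace Ω] {P : Measure Ω} [IsFiniteMeasure P] {p q : ℕ}
    (M : Matrix (Fin p) (Fin q) ℝ) {Y : Ω → Vec q} (hY : MemLp Y 2 P) :
    ∫ ω, mulV M (Y ω) ∂P = mulV M (∫ ω, Y ω ∂P) :=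
  (mulVL M).integral_comp_comm (hY.integrable (by norm_num))

theorem memLp_mulV {Ω : Type*} [MeasurableSpace Ω] {P : Measure Ω} {p q : ℕ}
    (M : Matrix (Fin p) (Fin q) ℝ) {Y : Ω → Vec q} (hY : MemLp Y 2 P) :
    MemLp (fun ω => mulV M (Y ω)) 2 P :=
  hY.continuousLinearMap_comp (mulVL M)

/-- This is `IndepFun.prodMk_left_of_right` for three copies of the identity of `Ω`, with different
σ-algebras on the target; pulling a product σ-algebra back along the diagonal gives the supremum. -/
theorem Indep.sup_left_of_right {Ω : Type*} {m₁ m₂ m₃ : MeasurableSpace Ω} [mΩ : MeasurableSpace Ω]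
    {P : Measure Ω} [IsProbabilityMeasure P] (h₁ : m₁ ≤ mΩ) (h₂ : m₂ ≤ mΩ) (h₃ : m₃ ≤ mΩ)
    (h : Indep m₁ (m₂ ⊔ m₃) P) (h' : Indep m₂ m₃ P) : Indep (m₁ ⊔ m₂) m₃ P := by
  have hsup : ∀ a b : MeasurableSpace Ω,
      MeasurableSpace.comap (fun ω : Ω => (ω, ω)) (a.prod b) = a ⊔ b := fun a b => by
    rw [MeasurableSpace.prod, MeasurableSpace.comap_sup, MeasurableSpace.comap_comp,
      MeasurableSpace.comap_comp]
    exact congrArg₂ _ MeasurableSpace.comap_id MeasurableSpace.comap_id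
  have key : Indep (MeasurableSpace.comap id m₁)
        (MeasurableSpace.comap (fun ω : Ω => (ω, ω)) (m₂.prod m₃)) P →
      Indep (MeasurableSpace.comap id m₂) (MeasurableSpace.comap id m₃) P →
      Indep (MeasurableSpace.comap (fun ω : Ω => (ω, ω)) (m₁.prod m₂))
        (MeasurableSpace.comap id m₃) P :=
    @IndepFun.prodMk_left_of_right Ω mΩ P _ Ω Ω Ω m₁ m₂ m₃ id id id
      (measurable_id'' h₁) (measurable_id'' h₂) (measurable_id'' h₃)
  simp only [hsup, MeasurableSpace.comap_id] at key
  exact key h h'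

/-- One step of the Kalman filter: the gain decorrelates the new estimation error from the
innovation, and the covariance of the estimation error follows the Riccati recursion. -/
theorem hasCov_kalman_step {Ω : Type*} [MeasurableSpace Ω] {P : Measure Ω} [IsProbabilityMeasure P]
    {n z d s : ℕ} {e : Ω → Vec n} {w : Ω → Vec d} {v : Ω → Vec s} {p : Ω → Vec n} {i : Ω → Vec z}
    {S Sp : Matrix (Fin n) (Fin n) ℝ} {Sw : Matrix (Fin d) (Fin d) ℝ}
    {Sv : Matrix (Fin s) (Fin s) ℝ} {Si : Matrix (Fin z) (Fin z) ℝ} {A : Matrix (Fin n) (Fin n) ℝ}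
    {W : Matrix (Fin n) (Fin d) ℝ} {H : Matrix (Fin z) (Fin n) ℝ} {V : Matrix (Fin z) (Fin s) ℝ}
    (hew : IndepFun e w P) (hev : IndepFun e v P) (hwv : IndepFun w v P)
    (me : MemLp e 2 P) (mw : MemLp w 2 P) (mv : MemLp v 2 P)
    (cee : HasCov P e e S) (cww : HasCov P w w Sw) (cvv : HasCov P v v Sv)
    (hp : p = fun ω => mulV A (e ω) + mulV W (w ω)) (hi : i = fun ω => mulV H (p ω) + mulV V (v ω))
    (hSp : Sp = A * S * A.transpose + W * Sw * W.transpose)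
    (hSi : Si = H * Sp * H.transpose + V * Sv * V.transpose) (hdet : IsUnit Si.det) :
    HasCov P (fun ω => p ω - mulV (Sp * H.transpose * Si⁻¹) (i ω)) i 0 ∧
      HasCov P (fun ω => p ω - mulV (Sp * H.transpose * Si⁻¹) (i ω))
        (fun ω => p ω - mulV (Sp * H.transpose * Si⁻¹) (i ω))
        ((1 - Sp * H.transpose * Si⁻¹ * H) * Sp) := by
  have mp : MemLp p 2 P := hp ▸ (memLp_mulV A me).add (memLp_mulV W mw)
  have mi : MemLp i 2 P := hi ▸ (memLp_mulV H mp).add (memLp_mulV V mv)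
  have cpe : HasCov P p e (A * S) := by
    have := (cee.mulV_left A).add_left ((hasCov_of_indepFun hew.symm mw me).mulV_left W)
      (memLp_mulV _ me) (memLp_mulV _ mw) me
    simpa [hp] using this
  have cpw : HasCov P p w (W * Sw) := by
    have := ((hasCov_of_indepFun hew me mw).mulV_left A).add_left (cww.mulV_left W)
      (memLp_mulV _ me) (memLp_mulV _ mw) mw
    simpa [hp] using this
  have cpv : HasCov P p v 0 := by
    have := ((hasCov_of_indepFun hev me mv).mulV_left A).add_left
      ((hasCov_of_indepFun hwv mw mv).mulV_left W) (memLp_mulV _ me) (memLp_mulV _ mw) mv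
    simpa [hp] using this
  have cvp : HasCov P v p 0 := by
    have := ((hasCov_of_indepFun hev.symm mv me).mulV_right A).add_right
      ((hasCov_of_indepFun hwv.symm mv mw).mulV_right W) mv (memLp_mulV _ me) (memLp_mulV _ mw)
    simpa [hp] using this
  have cpp : HasCov P p p Sp := by
    have := (cpe.mulV_right A).add_right (cpw.mulV_right W) mp (memLp_mulV _ me) (memLp_mulV _ mw)
    rwa [← hp, ← hSp] at this
  have cip : HasCov P i p (H * Sp) := by
    have := (cpp.mulV_left H).add_left (cvp.mulV_left V) (memLp_mulV _ mp) (memLp_mulV _ mv) mp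
    simpa [hi] using this
  have civ : HasCov P i v (V * Sv) := by
    have := (cpv.mulV_left H).add_left (cvv.mulV_left V) (memLp_mulV _ mp) (memLp_mulV _ mv) mv
    simpa [hi] using this
  have cii : HasCov P i i Si := by
    have := (cip.mulV_right H).add_right (civ.mulV_right V) mi (memLp_mulV _ mp) (memLp_mulV _ mv)
    rwa [← hi, ← hSi] at this
  have cpi : HasCov P p i (Sp * H.transpose) := by
    have := (cpp.mulV_right H).add_right (cpv.mulV_right V) mp (memLp_mulV _ mp) (memLp_mulV _ mv)
    simpa [hi] using this
  have cei := cpi.sub_left (cii.mulV_left (Sp * H.transpose * Si⁻¹)) mp (memLp_mulV _ mi) mi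
  -- The gain is the solution `K` of `K * Si = Sp * Hᵀ`, so the covariance of the new error with the
  -- innovation cancels.
  rw [Matrix.mul_assoc _ _ Si, Matrix.nonsing_inv_mul _ hdet, Matrix.mul_one, sub_self] at cei
  have cep := cpp.sub_left (cip.mulV_left (Sp * H.transpose * Si⁻¹)) mp (memLp_mulV _ mi) mp
  refine ⟨cei, ?_⟩
  -- As the new error is uncorrelated with the innovation, its covariance with itself equals its
  -- covariance with the prior error `p`.
  have := cep.sub_right (cei.mulV_right (Sp * H.transpose * Si⁻¹))
    (mp.sub (memLp_mulV _ mi)) mp (memLp_mulV _ mi)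
  rwa [Matrix.zero_mul, sub_zero, ← Matrix.mul_assoc,
    show Sp - Sp * H.transpose * Si⁻¹ * H * Sp = (1 - Sp * H.transpose * Si⁻¹ * H) * Sp by
      rw [Matrix.sub_mul, Matrix.one_mul]] at this

/-! ### Independence of the error and the innovation from the information. -/

namespace LQGame.NoiseModel

variable {N n z d s : ℕ} {m : Fin N → ℕ} {G : LQGame N n z d s m}
  {Ω : Type*} [MeasurableSpace Ω] {P : Measure Ω} (X : G.NoiseModel P)

/-- Disjoint families of sources are independent, and `y0` is independent of all sources together;
`Indep.sup_left_of_right` combines the two facts. -/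
theorem indep_past_noise [IsProbabilityMeasure P] (k : ℕ) :
    Indep (X.past k)
      (MeasurableSpace.comap (fun ω => (X.w k ω, X.v (k + 1) ω)) inferInstance) P := by
  have hle : ∀ c, MeasurableSpace.comap (X.ξ c) inferInstance ≤ ‹MeasurableSpace Ω› :=
    fun c => (X.ξ_measurable c).comap_le
  let T : Set Source := {c | c = .process k ∨ c = .meas (k + 1)}
  have hST : Disjoint (pastSources k) T := by
    rw [Set.disjoint_left]
    rintro c hc (rfl | rfl)
    · exact lt_irrefl k hc
    · exact Nat.not_succ_le_self k hc
  have hproc := indep_iSup_of_disjoint hle X.iIndep_ξ.iIndep hST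
  have hy := X.indep_y0
  rw [IndepFun_iff_Indep] at hy
  have hall : ∀ S : Set Source, (⨆ c ∈ S, MeasurableSpace.comap (X.ξ c) inferInstance) ≤
      MeasurableSpace.comap (fun ω c => X.ξ c ω) inferInstance := fun S => iSup₂_le fun c _ => by
    rw [← measurable_iff_comap_le]
    exact ((measurable_pi_apply (X := fun c : Source => Vec (c.dim n d s)) c).comp
      (comap_measurable _) :)
  have h1 := Indep.sup_left_of_right X.y0_measurable.comap_le (iSup₂_le fun c _ => hle c)
    (iSup₂_le fun c _ => hle c)
    (indep_of_indep_of_le_right hy (sup_le (hall (pastSources k)) (hall T))) hproc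
  refine indep_of_indep_of_le_right h1 ?_
  rw [← measurable_iff_comap_le]
  have hm : ∀ c ∈ T,
      Measurable[⨆ c ∈ T, MeasurableSpace.comap (X.ξ c) inferInstance] (X.ξ c) := fun c hc => by
    rw [measurable_iff_comap_le]
    exact le_iSup₂ (f := fun c _ => MeasurableSpace.comap (X.ξ c) inferInstance) c hc
  exact (hm (.process k) (Or.inl rfl)).prodMk (hm (.meas (k + 1)) (Or.inr rfl))

theorem indepFun_info_err_noise [IsProbabilityMeasure P] (σ : Profile z m) (k : ℕ)
    (hσ : ∀ i, ∀ t < k, Measurable (σ i t)) :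
    IndepFun (fun ω => (X.info σ k ω, X.err k ω)) (fun ω => (X.w k ω, X.v (k + 1) ω)) P :=
  (IndepFun_iff_Indep _ _ _).2 (indep_of_indep_of_le_left (X.indep_past_noise k)
    (X.measurable_past_info_err σ k hσ).comap_le)

theorem indepFun_w_v (k : ℕ) : IndepFun (X.w k) (X.v (k + 1)) P :=
  X.iIndep_ξ.indepFun (by simp)

theorem hasGaussianLaw_ξ (c : Source) : HasGaussianLaw (X.ξ c) P :=
  ⟨by rw [X.law_ξ]; infer_instance⟩

theorem integral_ξ (c : Source) : ∫ ω, X.ξ c ω ∂P = 0 := by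
  have h := integral_id_multivariateGaussian (μ := 0)
    (S := G.sourceCov (n := n) (d := d) (s := s) c)
  rwa [← X.law_ξ, integral_map (X.ξ_measurable c).aemeasurable (by fun_prop)] at h

theorem sourceCov_posSemidef (c : Source) : (G.sourceCov c).PosSemidef := by
  cases c with
  | init => exact G.cov0_posSemidef
  | process k => exact G.covW_posSemidef k
  | meas k => exact G.covV_posSemidef k

theorem memLp_w (k : ℕ) : MemLp (X.w k) 2 P := (X.hasGaussianLaw_ξ _).memLp_two

theorem memLp_v (k : ℕ) : MemLp (X.v k) 2 P := (X.hasGaussianLaw_ξ _).memLp_two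

variable [IsProbabilityMeasure P]

theorem hasCov_ξ (c : Source) : HasCov P (X.ξ c) (X.ξ c) (G.sourceCov c) :=
  hasCov_of_map_eq (sourceCov_posSemidef c) (X.ξ_measurable c) (X.law_ξ c)

theorem indepFun_err_noise (k : ℕ) :
    IndepFun (X.err k) (fun ω => (X.w k ω, X.v (k + 1) ω)) P :=
  -- The zero profile is an arbitrary choice, since the error does not depend on the profile.
  ((X.indepFun_info_err_noise (fun _ _ _ => 0) k fun _ _ _ => measurable_const).comp
    measurable_snd measurable_id :)

/-- A linear image of independent Gaussian vectors. The joint law matters: it lets zero covariance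
imply independence. -/
theorem hasGaussianLaw_err_innov_of {k : ℕ} (h : HasGaussianLaw (X.err k) P) :
    HasGaussianLaw (fun ω => (X.err (k + 1) ω, X.innov k ω)) P := by
  have h3 : HasGaussianLaw (fun ω => (X.err k ω, X.w k ω, X.v (k + 1) ω)) P :=
    (X.indepFun_err_noise k).hasGaussianLaw h
      ((X.indepFun_w_v k).hasGaussianLaw (X.hasGaussianLaw_ξ _) (X.hasGaussianLaw_ξ _))
  let fe := ContinuousLinearMap.fst ℝ (Vec n) (Vec d × Vec s)
  let fn := ContinuousLinearMap.snd ℝ (Vec n) (Vec d × Vec s)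
  let fw := (ContinuousLinearMap.fst ℝ (Vec d) (Vec s)).comp fn
  let fv := (ContinuousLinearMap.snd ℝ (Vec d) (Vec s)).comp fn
  let fp := (mulVL (G.A k)).comp fe + (mulVL (G.W k)).comp fw
  let fi := (mulVL (G.H (k + 1))).comp fp + (mulVL (G.V (k + 1))).comp fv
  exact h3.map_fun ((fp - (mulVL (G.gain k)).comp fi).prod fi)

theorem hasGaussianLaw_err (k : ℕ) : HasGaussianLaw (X.err k) P := by
  induction k with
  | zero => exact X.hasGaussianLaw_ξ _
  | succ k ih => exact (X.hasGaussianLaw_err_innov_of ih).fst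

theorem hasGaussianLaw_err_innov (k : ℕ) :
    HasGaussianLaw (fun ω => (X.err (k + 1) ω, X.innov k ω)) P :=
  X.hasGaussianLaw_err_innov_of (X.hasGaussianLaw_err k)

theorem memLp_err (k : ℕ) : MemLp (X.err k) 2 P := (X.hasGaussianLaw_err k).memLp_two

theorem memLp_innov (k : ℕ) : MemLp (X.innov k) 2 P := (X.hasGaussianLaw_err_innov k).snd.memLp_two

theorem memLp_priorErr (k : ℕ) : MemLp (X.priorErr k (X.err k)) 2 P :=
  (memLp_mulV _ (X.memLp_err k)).add (memLp_mulV _ (X.memLp_w k))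

theorem integral_priorErr {k : ℕ} (h : ∫ ω, X.err k ω ∂P = 0) :
    ∫ ω, X.priorErr k (X.err k) ω ∂P = 0 := by
  have hw : ∫ ω, X.w k ω ∂P = 0 := X.integral_ξ _
  simp only [priorErr]
  rw [integral_add ((memLp_mulV _ (X.memLp_err k)).integrable (by norm_num))
    ((memLp_mulV _ (X.memLp_w k)).integrable (by norm_num)), integral_mulV _ (X.memLp_err k),
    integral_mulV _ (X.memLp_w k), h, hw, mulV_zero, mulV_zero, add_zero]

theorem integral_innov_of {k : ℕ} (h : ∫ ω, X.err k ω ∂P = 0) :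
    ∫ ω, X.innov k ω ∂P = 0 := by
  have hv : ∫ ω, X.v (k + 1) ω ∂P = 0 := X.integral_ξ _
  simp only [innov, innovOf]
  rw [integral_add ((memLp_mulV _ (X.memLp_priorErr k)).integrable (by norm_num))
    ((memLp_mulV _ (X.memLp_v _)).integrable (by norm_num)), integral_mulV _ (X.memLp_priorErr k),
    integral_mulV _ (X.memLp_v _), X.integral_priorErr h, hv, mulV_zero, mulV_zero, add_zero]

theorem integral_err (k : ℕ) : ∫ ω, X.err k ω ∂P = 0 := by
  induction k with
  | zero => exact X.integral_ξ _
  | succ k ih =>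
    have hi : MemLp (X.innovOf k (X.err k)) 2 P := X.memLp_innov k
    have h0 : ∫ ω, X.innovOf k (X.err k) ω ∂P = 0 := X.integral_innov_of ih
    simp only [err]
    rw [integral_sub ((X.memLp_priorErr k).integrable (by norm_num))
      ((memLp_mulV _ hi).integrable (by norm_num)), integral_mulV _ hi, X.integral_priorErr ih,
      h0, mulV_zero, sub_zero]

theorem integral_innov (k : ℕ) : ∫ ω, X.innov k ω ∂P = 0 := X.integral_innov_of (X.integral_err k)

theorem hasCov_err_succ {k : ℕ}
    (hS : IsUnit (G.innovCov (k + 1) (G.predictCov k (G.postCov k))).det)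
    (h : HasCov P (X.err k) (X.err k) (G.postCov k)) :
    HasCov P (X.err (k + 1)) (X.innov k) 0 ∧
      HasCov P (X.err (k + 1)) (X.err (k + 1)) (G.postCov (k + 1)) :=
  hasCov_kalman_step (Sw := G.covW k) (Sv := G.covV (k + 1))
    ((X.indepFun_err_noise k).comp measurable_id measurable_fst)
    ((X.indepFun_err_noise k).comp measurable_id measurable_snd) (X.indepFun_w_v k) (X.memLp_err k)
    (X.memLp_w k) (X.memLp_v (k + 1)) h (X.hasCov_ξ (.process k)) (X.hasCov_ξ (.meas (k + 1)))
    rfl rfl rfl rfl hS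

theorem hasCov_err (hK : G.KalmanWellPosed) {k : ℕ} (hk : k ≤ G.L) :
    HasCov P (X.err k) (X.err k) (G.postCov k) := by
  induction k with
  | zero => exact X.hasCov_ξ .init
  | succ k ih => exact (X.hasCov_err_succ (hK k hk) (ih (by omega))).2

theorem indepFun_err_innov (hK : G.KalmanWellPosed) {k : ℕ} (hk : k < G.L) :
    IndepFun (X.err (k + 1)) (X.innov k) P :=
  (X.hasGaussianLaw_err_innov k).indepFun_of_covariance_inner fun a b => by
    rw [(X.hasCov_err_succ (hK k hk) (X.hasCov_err hK hk.le)).1 a b]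
    simp [mulV]

/-- The information is independent of the triple of current error and fresh noises, and the new
error and innovation are functions of that triple. -/
theorem indepFun_info_noise_of {σ : Profile z m} {k : ℕ} (hσ : ∀ i, ∀ t < k, Measurable (σ i t))
    (h : IndepFun (X.info σ k) (X.err k) P) :
    IndepFun (X.info σ k) (fun ω => (X.err (k + 1) ω, X.innov k ω)) P := by
  have h1 := IndepFun.prodMk_right_of_left (X.measurable_info σ k hσ) (X.measurable_err k)
    ((X.measurable_w k).prodMk (X.measurable_v (k + 1))) (X.indepFun_info_err_noise σ k hσ) h
  have hi : Measurable (fun p : Vec n × Vec d × Vec s =>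
      mulV (G.H (k + 1)) (mulV (G.A k) p.1 + mulV (G.W k) p.2.1) +
        mulV (G.V (k + 1)) p.2.2) := by fun_prop
  have he : Measurable (fun p : Vec n × Vec d × Vec s =>
      mulV (G.A k) p.1 + mulV (G.W k) p.2.1 - mulV (G.gain k)
        (mulV (G.H (k + 1)) (mulV (G.A k) p.1 + mulV (G.W k) p.2.1) +
        mulV (G.V (k + 1)) p.2.2)) := by fun_prop
  exact (h1.comp measurable_id (he.prodMk hi) :)

/-- The estimation error is independent of the information. -/
theorem indepFun_info_err (hK : G.KalmanWellPosed) {σ : Profile z m}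
    (hσ : ∀ i, ∀ t < G.L, Measurable (σ i t)) {k : ℕ} (hk : k ≤ G.L) :
    IndepFun (X.info σ k) (X.err k) P := by
  induction k with
  | zero =>
    have h1 := X.indep_y0.comp (φ := fun y => ((fun _ => y, fun t => t.elim0) : History z m 0))
      (ψ := fun x : ((c : Source) → Vec (c.dim n d s)) => x .init)
      (Measurable.prodMk (by fun_prop) (measurable_pi_lambda _ fun t => t.elim0))
      (measurable_pi_apply (X := fun c : Source => Vec (c.dim n d s)) Source.init)
    exact h1
  | succ k ih =>
    have hσk : ∀ i, ∀ t < k, Measurable (σ i t) := fun i t ht => hσ i t (by omega)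
    have h1 := (X.indepFun_info_noise_of hσk (ih (by omega))).comp measurable_id measurable_swap
    -- The next information is a function of the current one and the innovation, so it suffices that
    -- this pair is independent of the new error.
    have h2 := IndepFun.prodMk_left_of_right (X.measurable_info σ k hσk) (X.measurable_innov k)
      (X.measurable_err (k + 1)) h1 (X.indepFun_err_innov hK hk).symm
    have h3 : X.info σ (k + 1) = G.nextInfo σ k ∘ fun ω => (X.info σ k ω, X.innov k ω) :=
      funext fun ω => X.info_succ σ k ω
    rw [h3]
    exact h2.comp (G.measurable_nextInfo σ k fun i => hσ i k hk) measurable_id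

/-- The innovation is independent of the information. -/
theorem indepFun_info_innov (hK : G.KalmanWellPosed) {σ : Profile z m}
    (hσ : ∀ i, ∀ t < G.L, Measurable (σ i t)) {k : ℕ} (hk : k ≤ G.L) :
    IndepFun (X.info σ k) (X.innov k) P :=
  (X.indepFun_info_noise_of (fun i t ht => hσ i t (by omega))
    (X.indepFun_info_err hK hσ hk)).comp measurable_id measurable_snd

end LQGame.NoiseModel

namespace LQGame

variable {N n z d s : ℕ} {m : Fin N → ℕ} (G : LQGame N n z d s m)

/-! ### Dynamic programming in the deterministic game -/

/-- The remaining cost of player `i` from the state `x` at time `t` under `γ`. -/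
noncomputable def detVal (γ : DetProfile n m) (i : Fin N) (t : ℕ) (x : Vec n) : ℝ :=
  G.detCost γ i (G.L - t) t x

/-- The remaining cost of player `i` from a state at time `t` if arbitrary controls are used at
time `t` and `γ` afterwards. -/
noncomputable def detQ (γ : DetProfile n m) (i : Fin N) (t : ℕ)
    (p : Vec n × ((j : Fin N) → Vec (m j))) : ℝ :=
  G.stageCost i t p.1 p.2 + G.detVal γ i (t + 1) (G.drift t p.1 p.2)

theorem detVal_horizon (γ : DetProfile n m) (i : Fin N) :
    G.detVal γ i G.L = G.terminalCost i := by
  funext x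
  simp [detVal, detCost]

theorem detVal_eq_detQ (γ : DetProfile n m) (i : Fin N) {t : ℕ} (ht : t < G.L) (x : Vec n) :
    G.detVal γ i t x = G.detQ γ i t (x, fun j => γ j t x) := by
  rw [detVal, detQ, detVal, show G.L - t = (G.L - (t + 1)) + 1 by omega]
  rfl

theorem detCost_congr {γ γ' : DetProfile n m} (i : Fin N) (r t : ℕ)
    (h : ∀ j, ∀ t' ≥ t, γ j t' = γ' j t') (x : Vec n) :
    G.detCost γ i r t x = G.detCost γ' i r t x := by
  induction r generalizing t x with
  | zero => rfl
  | succ r ih =>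
    simp only [detCost, h _ t le_rfl]
    rw [ih (t + 1) fun j t' ht' => h j t' (by omega)]

/-- No player gains by changing her control at time `t` only. -/
def OneShot (γ : DetProfile n m) (t : ℕ) : Prop :=
  ∀ (x : Vec n) (i : Fin N) (w : Vec (m i)),
    G.detVal γ i t x ≤ G.detQ γ i t (x, Function.update (fun j => γ j t x) i w)

theorem IsDetFeedbackNash.oneShot {G : LQGame N n z d s m} {γ : DetProfile n m}
    (h : G.IsDetFeedbackNash γ) {t : ℕ} (ht : t < G.L) : G.OneShot γ t := fun x i w => by
  let δ : ℕ → Vec n → Vec (m i) := fun t' y => if t' = t then w else γ i t' y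
  refine (h t ht x i δ).trans (le_of_eq ?_)
  have h1 : ∀ j, ∀ t' ≥ t + 1, Function.update γ i δ j t' = γ j t' := fun j t' ht' => by
    by_cases hj : j = i
    · subst hj
      funext y
      simp [δ, show t' ≠ t by omega]
    · simp [Function.update_of_ne hj]
  have h2 : (fun j => Function.update γ i δ j t x) =
      Function.update (fun j => γ j t x) i w := by
    funext j
    by_cases hj : j = i
    · subst hj
      simp [δ]
    · simp [Function.update_of_ne hj]
  rw [show G.L - t = (G.L - (t + 1)) + 1 by omega, detCost, h2, G.detCost_congr i _ _ h1]
  rfl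

/-- One-shot deviation principle: by backward induction, the first move of `δ` does not help against
the values of `γ`, and these are at most the values of the deviation. -/
theorem isDetFeedbackNash_of_oneShot {γ : DetProfile n m}
    (h : ∀ t < G.L, G.OneShot γ t) : G.IsDetFeedbackNash γ := fun k hk x i δ => by
  have key : ∀ r t, t + r = G.L → ∀ x,
      G.detCost γ i r t x ≤ G.detCost (Function.update γ i δ) i r t x := fun r => by
    induction r with
    | zero => exact fun _ _ _ => le_rfl
    | succ r ih =>
      intro t ht x
      have h1 := h t (by omega) x i (δ t x)
      have h2 : (fun j => Function.update γ i δ j t x) =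
          Function.update (fun j => γ j t x) i (δ t x) := by
        funext j
        by_cases hj : j = i
        · subst hj
          simp
        · simp [Function.update_of_ne hj]
      rw [detVal, detQ, detVal, show G.L - t = r + 1 by omega,
        show G.L - (t + 1) = r by omega] at h1
      rw [detCost.eq_2 G (Function.update γ i δ), h2]
      exact h1.trans (add_le_add_right (ih (t + 1) (by omega) _) _)
  exact key _ k (by omega) x

theorem isQuad_stageCost (i : Fin N) (k : ℕ) :
    IsQuad (fun p : Vec n × ((j : Fin N) → Vec (m j)) => G.stageCost i k p.1 p.2) := by
  refine ((isQuad_quadForm _ _).comp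
    (ContinuousLinearMap.fst ℝ (Vec n) ((j : Fin N) → Vec (m j))).isAff).add
    (IsQuad.sum fun j _ => (isQuad_quadForm _ _).comp ?_)
  exact ((ContinuousLinearMap.proj (R := ℝ) (φ := fun j => Vec (m j)) j).comp
      (ContinuousLinearMap.snd ℝ (Vec n) ((j : Fin N) → Vec (m j)))).isAff

variable {G}

theorem IsAffineProfile.isAff {γ : DetProfile n m} (hγ : G.IsAffineProfile γ) {t : ℕ}
    (ht : t < G.L) : IsAff (fun x => fun j => γ j t x) :=
  IsAff.pi fun j => by
    obtain ⟨f, hf⟩ := hγ j t ht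
    simpa only [funext hf] using f.isAff

theorem IsAffineProfile.isAff_graph {γ : DetProfile n m} (hγ : G.IsAffineProfile γ) {t : ℕ}
    (ht : t < G.L) : IsAff (fun x => (x, fun j => γ j t x)) :=
  (ContinuousLinearMap.id ℝ (Vec n)).isAff.prodMk (hγ.isAff ht)

theorem isQuad_detQ_of {γ : DetProfile n m} {i : Fin N} {t : ℕ}
    (h : IsQuad (G.detVal γ i (t + 1))) : IsQuad (G.detQ γ i t) :=
  (G.isQuad_stageCost i t).add (h.comp (G.isAff_drift t))

/-- Affine strategies are needed here: composition with affine maps keeps a function quadratic. -/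
theorem IsAffineProfile.isQuad_detVal {γ : DetProfile n m} (hγ : G.IsAffineProfile γ) (i : Fin N)
    {t : ℕ} (ht : t ≤ G.L) : IsQuad (G.detVal γ i t) := by
  induction ht using Nat.decreasingInduction with
  | self => exact G.detVal_horizon γ i ▸ isQuad_quadForm _ _
  | of_succ t ht ih =>
    rw [funext (G.detVal_eq_detQ γ i ht)]
    exact (isQuad_detQ_of ih).comp (hγ.isAff_graph ht)

theorem IsAffineProfile.isQuad_detQ {γ : DetProfile n m} (hγ : G.IsAffineProfile γ) (i : Fin N)
    {t : ℕ} (ht : t < G.L) : IsQuad (G.detQ γ i t) :=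
  isQuad_detQ_of (hγ.isQuad_detVal i ht)

end LQGame

namespace LQGame.NoiseModel

variable {N n z d s : ℕ} {m : Fin N → ℕ} {G : LQGame N n z d s m}
  {Ω : Type*} [MeasurableSpace Ω] {P : Measure Ω} (X : G.NoiseModel P)

/-! ### Expected costs in terms of the estimates -/

/-- The state estimate at time `k`. -/
noncomputable def estimate (σ : Profile z m) (k : ℕ) (ω : Ω) : Vec n := G.xhat k (X.info σ k ω)

/-- The state estimate at time `k` together with the controls at time `k`. -/
noncomputable def estCtrl (σ : Profile z m) (k : ℕ) (ω : Ω) : Vec n × ((j : Fin N) → Vec (m j)) :=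
  (X.estimate σ k ω, fun j => X.control σ j k ω)

theorem play_congr {σ σ' : Profile z m} {k : ℕ} (h : ∀ j, ∀ t < k, σ j t = σ' j t) (ω : Ω) :
    X.play σ ω k = X.play σ' ω k := by
  induction k with
  | zero => rfl
  | succ k ih =>
    simp only [play, ih fun j t ht => h j t (by omega), h _ k (Nat.lt_succ_self k)]

theorem info_congr {σ σ' : Profile z m} {k : ℕ} (h : ∀ j, ∀ t < k, σ j t = σ' j t) :
    X.info σ k = X.info σ' k :=
  funext fun ω => congrArg Prod.snd (X.play_congr h ω)

theorem control_congr {σ σ' : Profile z m} {k : ℕ} (h : ∀ j, ∀ t ≤ k, σ j t = σ' j t) (i : Fin N) :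
    X.control σ i k = X.control σ' i k :=
  funext fun ω => by
    rw [control, control, h i k le_rfl, X.info_congr fun j t ht => h j t ht.le]

theorem estCtrl_congr {σ σ' : Profile z m} {k : ℕ} (h : ∀ j, ∀ t ≤ k, σ j t = σ' j t) :
    X.estCtrl σ k = X.estCtrl σ' k :=
  funext fun ω => by
    simp only [estCtrl, estimate, X.control_congr h, X.info_congr fun j t ht => h j t (le_of_lt ht)]

variable {X}

/-- The expected loss of player `i` at time `k` relative to the value function of `γ`. -/
noncomputable def gap (X : G.NoiseModel P) (γ : DetProfile n m) (σ : Profile z m) (i : Fin N)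
    (k : ℕ) : ℝ :=
  ∫ ω, (G.detQ γ i k (X.estCtrl σ k ω) - G.detVal γ i k (X.estimate σ k ω)) ∂P

theorem gap_eq_zero {γ : DetProfile n m} {σ : Profile z m} {k : ℕ} (hk : k < G.L)
    (h : ∀ j, ∀ᵐ ω ∂P, X.control σ j k ω = γ j k (X.estimate σ k ω)) (i : Fin N) :
    X.gap γ σ i k = 0 := by
  refine integral_eq_zero_of_ae ?_
  filter_upwards [ae_all_iff.2 h] with ω hω
  rw [G.detVal_eq_detQ γ i hk]
  simp [estCtrl, hω]

/-- The integrand is nonnegative pointwise, by one-shot optimality of `γ` at the current estimate.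
-/
theorem gap_nonneg {γ : DetProfile n m} {σ : Profile z m} {k : ℕ} (hγ : G.OneShot γ k) (i : Fin N)
    (h : ∀ j ≠ i, ∀ ω, X.control σ j k ω = γ j k (X.estimate σ k ω)) :
    0 ≤ X.gap γ σ i k := by
  refine integral_nonneg fun ω => sub_nonneg.2 ?_
  have h1 : X.estCtrl σ k ω = (X.estimate σ k ω,
      Function.update (fun j => γ j k (X.estimate σ k ω)) i (X.control σ i k ω)) := by
    refine Prod.ext rfl (funext fun j => ?_)
    by_cases hj : j = i
    · subst hj
      simp [estCtrl]
    · simp [estCtrl, h j hj, Function.update_of_ne hj]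
  rw [h1]
  exact hγ _ _ _

theorem gap_congr {γ : DetProfile n m} {σ σ' : Profile z m} {k : ℕ}
    (h : ∀ j, ∀ t ≤ k, σ j t = σ' j t) (i : Fin N) : X.gap γ σ i k = X.gap γ σ' i k := by
  have h1 : ∀ σ, X.estimate σ k = fun ω => (X.estCtrl σ k ω).1 := fun _ => rfl
  rw [gap, gap, h1, h1, X.estCtrl_congr h]

variable (X) [IsProbabilityMeasure P]

theorem memLp_estimate {σ : Profile z m} {k : ℕ} (h : ∀ i, ∀ t < k, MemLp (X.control σ i t) 2 P) :
    MemLp (X.estimate σ k) 2 P := by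
  induction k with
  | zero => exact X.memLp_xhat0
  | succ k ih =>
    have h1 := ih fun i t ht => h i t (by omega)
    have h2 := (G.isAff_drift k).memLp (MemLp.prodMk' h1
      (MemLp.of_eval (f := fun ω j => X.control σ j k ω) fun j => h j k (by omega)))
    have h3 := h2.add (memLp_mulV (G.gain k) (X.memLp_innov k))
    exact (memLp_congr_ae (.of_forall fun ω => X.xhat_info_succ σ k ω)).2 h3

variable {X}

theorem Admissible.memLp_estimate {σ : Profile z m} (hσ : X.Admissible σ) {k : ℕ} (hk : k ≤ G.L) :
    MemLp (X.estimate σ k) 2 P :=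
  X.memLp_estimate fun i t ht => (hσ i t (by omega)).2

theorem Admissible.memLp_estCtrl {σ : Profile z m} (hσ : X.Admissible σ) {k : ℕ} (hk : k < G.L) :
    MemLp (X.estCtrl σ k) 2 P :=
  MemLp.prodMk' (hσ.memLp_estimate hk.le) (MemLp.of_eval fun j => (hσ j k hk).2)

/-- The second integral involves only the innovation, so it is the same for all profiles. -/
theorem Admissible.integral_estimate_succ (hK : G.KalmanWellPosed) {σ : Profile z m}
    (hσ : X.Admissible σ) {k : ℕ} (hk : k < G.L) {f : Vec n → ℝ} (hf : IsQuad f) :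
    ∫ ω, f (X.estimate σ (k + 1) ω) ∂P =
      ∫ ω, f (G.drift k (X.estCtrl σ k ω).1 (X.estCtrl σ k ω).2) ∂P +
        ∫ ω, (f (mulV (G.gain k) (X.innov k ω)) - f 0) ∂P := by
  have hm : Measurable (fun I : History z m k => G.drift k (G.xhat k I) (fun j => σ j k I)) :=
    ((G.measurable_drift k).comp ((G.measurable_xhat k).prodMk
      (measurable_pi_lambda _ fun j => (hσ j k hk).1)) :)
  have hind := (X.indepFun_info_innov hK (fun i t ht => (hσ i t ht).1) hk.le).comp hm
    (measurable_mulV (G.gain k))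
  have hzero : ∫ ω, mulV (G.gain k) (X.innov k ω) ∂P = 0 := by
    rw [integral_mulV _ (X.memLp_innov k), X.integral_innov, mulV_zero]
  rw [← hf.integral_add ((G.isAff_drift k).memLp (hσ.memLp_estCtrl hk))
    (memLp_mulV (G.gain k) (X.memLp_innov k)) hind hzero]
  exact integral_congr_ae (.of_forall fun ω => congrArg f (X.xhat_info_succ σ k ω))

theorem Admissible.integral_state (hK : G.KalmanWellPosed) {σ : Profile z m}
    (hσ : X.Admissible σ) {k : ℕ} (hk : k ≤ G.L) {f : Vec n → ℝ} (hf : IsQuad f) :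
    ∫ ω, f (X.state σ k ω) ∂P =
      ∫ ω, f (X.estimate σ k ω) ∂P + ∫ ω, (f (X.err k ω) - f 0) ∂P := by
  rw [← hf.integral_add (hσ.memLp_estimate hk) (X.memLp_err k)
    ((X.indepFun_info_err hK (fun i t ht => (hσ i t ht).1) hk).comp (G.measurable_xhat k)
      measurable_id) (X.integral_err k)]
  simp only [state_eq]
  rfl

theorem Admissible.memLp_state {σ : Profile z m} (hσ : X.Admissible σ) {k : ℕ} (hk : k ≤ G.L) :
    MemLp (X.state σ k) 2 P :=
  (memLp_congr_ae (.of_forall fun ω => X.state_eq σ k ω)).2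
    ((hσ.memLp_estimate hk).add (X.memLp_err k))

theorem Admissible.integral_stageCost (hK : G.KalmanWellPosed) {σ : Profile z m}
    (hσ : X.Admissible σ) {k : ℕ} (hk : k < G.L) (i : Fin N) :
    ∫ ω, G.stageCost i k (X.state σ k ω) (fun j => X.control σ j k ω) ∂P =
      ∫ ω, G.stageCost i k (X.estCtrl σ k ω).1 (X.estCtrl σ k ω).2 ∂P +
        ∫ ω, (quadForm (G.Q i k) (G.l i k) (X.err k ω) - quadForm (G.Q i k) (G.l i k) 0) ∂P := by
  have hu : Integrable (fun ω => ∑ j, quadForm (G.R i k j) (G.r i k j) (X.control σ j k ω)) P :=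
    integrable_finsetSum _ fun j _ => (isQuad_quadForm _ _).integrable (hσ j k hk).2
  have h1 := integral_add ((isQuad_quadForm (G.Q i k) (G.l i k)).integrable
    (hσ.memLp_state hk.le)) hu
  have h2 := integral_add ((isQuad_quadForm (G.Q i k) (G.l i k)).integrable
    (hσ.memLp_estimate hk.le)) hu
  have h3 := hσ.integral_state hK hk.le (isQuad_quadForm (G.Q i k) (G.l i k))
  simp only [stageCost, estCtrl]
  rw [h1, h2, h3]
  ring

theorem Admissible.gap_eq {γ : DetProfile n m} (hγ : G.IsAffineProfile γ) {σ : Profile z m}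
    (hσ : X.Admissible σ) (i : Fin N) {k : ℕ} (hk : k < G.L) :
    X.gap γ σ i k =
      ∫ ω, G.detQ γ i k (X.estCtrl σ k ω) ∂P - ∫ ω, G.detVal γ i k (X.estimate σ k ω) ∂P :=
  integral_sub ((hγ.isQuad_detQ i hk).integrable (hσ.memLp_estCtrl hk))
    ((hγ.isQuad_detVal i hk.le).integrable (hσ.memLp_estimate hk.le))

/-- The expected cost of an admissible profile is the sum of its expected losses relative to the
value functions of an affine feedback profile, up to a constant that does not depend on it. -/
theorem exists_cost_eq_add_sum_gap (X : G.NoiseModel P) (hK : G.KalmanWellPosed)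
    {γ : DetProfile n m} (hγ : G.IsAffineProfile γ) (i : Fin N) :
    ∃ C : ℝ, ∀ σ : Profile z m, X.Admissible σ →
      X.cost σ i = C + ∑ k ∈ Finset.range G.L, X.gap γ σ i k := by
  -- `c` collects the cost of the estimation error, `b` the effect of the innovation on the
  -- continuation value; neither involves the profile.
  let c : ℕ → ℝ := fun k =>
    ∫ ω, (quadForm (G.Q i k) (G.l i k) (X.err k ω) - quadForm (G.Q i k) (G.l i k) 0) ∂P
  let b : ℕ → ℝ := fun k => ∫ ω, (G.detVal γ i (k + 1) (mulV (G.gain k) (X.innov k ω)) -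
    G.detVal γ i (k + 1) 0) ∂P
  refine ⟨∫ ω, G.detVal γ i 0 (G.xhat0 (X.y0 ω)) ∂P + c G.L +
    ∑ k ∈ Finset.range G.L, (c k + b k), fun σ hσ => ?_⟩
  have hstage : ∀ k ∈ Finset.range G.L, Integrable (fun ω =>
      G.stageCost i k (X.state σ k ω) (fun j => X.control σ j k ω)) P := fun k hk => by
    have hk := Finset.mem_range.1 hk
    exact (G.isQuad_stageCost i k).integrable (X := fun ω => (X.state σ k ω, fun j =>
      X.control σ j k ω)) (MemLp.prodMk' (hσ.memLp_state hk.le) (MemLp.of_eval fun j =>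
        (hσ j k hk).2))
  have hterm : IsQuad (G.terminalCost i) := isQuad_quadForm _ _
  -- Bellman's equation with the noise constants made explicit; its differences of values telescope,
  -- leaving the initial value, common to all profiles, and the terminal cost.
  have h1 : ∀ k ∈ Finset.range G.L,
      ∫ ω, G.stageCost i k (X.state σ k ω) (fun j => X.control σ j k ω) ∂P =
        (∫ ω, G.detVal γ i k (X.estimate σ k ω) ∂P -
          ∫ ω, G.detVal γ i (k + 1) (X.estimate σ (k + 1) ω) ∂P) + (c k + b k) +
          X.gap γ σ i k := fun k hk => by
    have hk := Finset.mem_range.1 hk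
    have hV := hγ.isQuad_detVal i (t := k + 1) hk
    have h2 := hσ.integral_stageCost hK hk i
    have h3 := hσ.integral_estimate_succ hK hk hV
    have h4 := hσ.gap_eq hγ i hk
    have h5 : ∫ ω, G.detQ γ i k (X.estCtrl σ k ω) ∂P =
        ∫ ω, G.stageCost i k (X.estCtrl σ k ω).1 (X.estCtrl σ k ω).2 ∂P +
        ∫ ω, G.detVal γ i (k + 1) (G.drift k (X.estCtrl σ k ω).1 (X.estCtrl σ k ω).2) ∂P :=
      integral_add ((G.isQuad_stageCost i k).integrable (hσ.memLp_estCtrl hk))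
        (hV.integrable ((G.isAff_drift k).memLp (hσ.memLp_estCtrl hk)))
    simp only [c, b]
    linarith
  rw [cost, integral_add (hterm.integrable (hσ.memLp_state le_rfl))
    (integrable_finsetSum _ hstage), integral_finsetSum _ hstage, Finset.sum_congr rfl h1,
    Finset.sum_add_distrib, Finset.sum_add_distrib, Finset.sum_range_sub',
    hσ.integral_state hK le_rfl hterm, G.detVal_horizon]
  have h6 : ∫ ω, G.detVal γ i 0 (X.estimate σ 0 ω) ∂P =
    ∫ ω, G.detVal γ i 0 (G.xhat0 (X.y0 ω)) ∂P := rfl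
  rw [h6]
  simp only [c, terminalCost]
  ring

/-! ### The separation principle -/

theorem splice_of_lt {k t : ℕ} (h : t < k) (τ σ : Profile z m) (i : Fin N) :
    splice k τ σ i t = τ i t := by
  funext I
  simp [splice, h]

theorem splice_of_le {k t : ℕ} (h : k ≤ t) (τ σ : Profile z m) (i : Fin N) :
    splice k τ σ i t = σ i t := by
  funext I
  simp [splice, not_lt.2 h]

/-- Square integrability passes forward in time through the filter and the affine strategies. Only
the part of `τ` before `k` is constrained, so that `τ` may be a deviation whose later admissibility
is still unknown. -/
theorem admissible_splice_atEstimate {γ : DetProfile n m} (hγ : G.IsAffineProfile γ)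
    {τ : Profile z m} {k : ℕ}
    (hτ : ∀ i, ∀ t < G.L, t < k → Measurable (τ i t) ∧ MemLp (X.control τ i t) 2 P) :
    X.Admissible (splice k τ (G.atEstimate γ)) := by
  have key : ∀ t < G.L, ∀ i, MemLp (X.control (splice k τ (G.atEstimate γ)) i t) 2 P := by
    intro t
    induction t using Nat.strong_induction_on with
    | _ t ih =>
      intro ht i
      by_cases htk : t < k
      · rw [X.control_congr (σ' := τ) fun j t' ht' => splice_of_lt (by omega) τ _ j]
        exact (hτ i t ht htk).2
      · obtain ⟨f, hf⟩ := hγ i t ht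
        have h1 := f.isAff.memLp
          (X.memLp_estimate (σ := splice k τ (G.atEstimate γ)) (k := t)
            fun j t' ht' => ih t' ht' (by omega) j)
        refine (memLp_congr_ae (.of_forall fun ω => ?_)).2 h1
        simp only [control, splice_of_le (not_lt.1 htk), atEstimate, hf, estimate]
  intro i t ht
  refine ⟨?_, key t ht i⟩
  by_cases htk : t < k
  · rw [splice_of_lt htk]
    exact (hτ i t ht htk).1
  · rw [splice_of_le (not_lt.1 htk)]
    obtain ⟨f, hf⟩ := hγ i t ht
    have h1 := f.isAff.continuous.measurable.comp (G.measurable_xhat t)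
    rwa [← show G.atEstimate γ i t = f ∘ G.xhat t from funext fun I => hf _] at h1

theorem Admissible.splice_atEstimate {γ : DetProfile n m} (hγ : G.IsAffineProfile γ)
    {τ : Profile z m} (hτ : X.Admissible τ) (k : ℕ) :
    X.Admissible (splice k τ (G.atEstimate γ)) :=
  admissible_splice_atEstimate hγ fun i t ht _ => hτ i t ht

/-- The gaps are compared one by one: before `k` they coincide, and from `k` on they are zero for
`γ` and nonnegative for the deviation. -/
theorem isFeedbackNash_atEstimate (hK : G.KalmanWellPosed) {γ : DetProfile n m}
    (hγ : G.IsAffineProfile γ) (hNash : G.IsDetFeedbackNash γ) :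
    X.IsFeedbackNash (G.atEstimate γ) := by
  refine fun τ hτ k hk => ⟨hτ.splice_atEstimate hγ k, fun i δ hδ => ?_⟩
  obtain ⟨C, hC⟩ := X.exists_cost_eq_add_sum_gap hK hγ i
  rw [hC _ (hτ.splice_atEstimate hγ k), hC _ hδ]
  refine add_le_add_right (Finset.sum_le_sum fun t ht => ?_) C
  have ht := Finset.mem_range.1 ht
  by_cases htk : t < k
  · refine le_of_eq (gap_congr (fun j t' ht' => ?_) i)
    rw [splice_of_lt (by omega), splice_of_lt (by omega)]
  · rw [gap_eq_zero ht]
    · refine gap_nonneg (hNash.oneShot ht) i fun j hj ω => ?_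
      rw [control, splice_of_le (not_lt.1 htk), Function.update_of_ne hj]
      rfl
    · refine fun j => .of_forall fun ω => ?_
      rw [control, splice_of_le (not_lt.1 htk)]
      rfl

theorem splice_zero (τ σ : Profile z m) : splice 0 τ σ = σ := by
  funext i t
  exact splice_of_le (Nat.zero_le t) τ σ i

theorem admissible_zero (X : G.NoiseModel P) : X.Admissible (fun _ _ _ => 0) :=
  fun _ _ _ => ⟨measurable_const, memLp_const 0⟩

theorem IsFeedbackNash.isNash {σ : Profile z m} (h : X.IsFeedbackNash σ) : X.IsNash σ := by
  have h1 := h _ X.admissible_zero 0 (Nat.zero_le _)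
  simpa only [splice_zero] using! h1

end LQGame.NoiseModel

/-! ### Directional derivatives of quadratic functions. -/

section Quad

variable {E : Type*} [NormedAddCommGroup E] [NormedSpace ℝ E]

/-- The directional derivative of a quadratic function. -/
noncomputable def slopeAlong (f : E → ℝ) (p s : E) : ℝ := (f (p + s) - f (p - s)) / 2

/-- The symmetric difference cancels the second-order term, so it is the exact derivative. -/
theorem slopeAlong_eq {f : E → ℝ} {B : E →L[ℝ] E →L[ℝ] ℝ} {l : E →L[ℝ] ℝ} {c : ℝ}
    (h : ∀ x, f x = B x x + l x + c) (p s : E) : slopeAlong f p s = B p s + B s p + l s := by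
  simp only [slopeAlong, h, map_add, map_sub, _root_.add_apply, _root_.sub_apply]
  ring

theorem IsQuad.apply_add_smul {f : E → ℝ} (h : IsQuad f) (p s : E) (a : ℝ) :
    f (p + a • s) = f p + a * slopeAlong f p s + a ^ 2 / 2 * polarForm f s s := by
  obtain ⟨B, l, c, h⟩ := h
  rw [slopeAlong_eq h, polarForm_eq h]
  simp only [h, map_add, map_smul, _root_.add_apply, _root_.smul_apply, smul_eq_mul]
  ring

theorem IsQuad.apply_add {f : E → ℝ} (h : IsQuad f) (p s : E) :
    f (p + s) = f p + slopeAlong f p s + polarForm f s s / 2 := by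
  have := h.apply_add_smul p s 1
  rw [one_smul] at this
  rw [this]
  ring

theorem IsQuad.slopeAlong_add {f : E → ℝ} (h : IsQuad f) (p q s : E) :
    slopeAlong f (p + q) s = slopeAlong f p s + polarForm f q s := by
  obtain ⟨B, l, c, h⟩ := h
  rw [slopeAlong_eq h, slopeAlong_eq h, polarForm_eq h]
  simp only [map_add, _root_.add_apply]
  ring

theorem IsQuad.isAff_slopeAlong {f : E → ℝ} (h : IsQuad f) (s : E) :
    IsAff (fun p => slopeAlong f p s) := by
  obtain ⟨B, l, c, h⟩ := h
  exact ⟨B.flip s + B s, l s, fun p => slopeAlong_eq h p s⟩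

theorem IsQuad.exists_slopeAlong_eq {f : E → ℝ} (h : IsQuad f) (p : E) :
    ∃ D : E →L[ℝ] ℝ, ∀ s, slopeAlong f p s = D s := by
  obtain ⟨B, l, c, h⟩ := h
  exact ⟨B p + B.flip p + l, fun s => by rw [slopeAlong_eq h]; rfl⟩

end Quad

namespace LQGame

variable {N n z d s : ℕ} {m : Fin N → ℕ} {G : LQGame N n z d s m}

/-! ### Uniqueness of affine feedback equilibria -/

/-- The direction in which only player `i` changes her control. -/
noncomputable def ownDir (n : ℕ) (m : Fin N → ℕ) (i : Fin N) :
    Vec (m i) →L[ℝ] Vec n × ((j : Fin N) → Vec (m j)) :=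
  (ContinuousLinearMap.inr ℝ (Vec n) ((j : Fin N) → Vec (m j))).comp
    (ContinuousLinearMap.single ℝ (fun j => Vec (m j)) i)

theorem mk_update_eq (x : Vec n) (u : (j : Fin N) → Vec (m j)) (i : Fin N) (w : Vec (m i)) :
    (x, Function.update u i w) = (x, u) + ownDir n m i (w - u i) := by
  refine Prod.ext (by simp [ownDir]) (funext fun j => ?_)
  by_cases hj : j = i
  · subst hj
    simp [ownDir]
  · simp [ownDir, Function.update_of_ne hj, Pi.single_eq_of_ne hj]

theorem drift_add_ownDir (t : ℕ) (p : Vec n × ((j : Fin N) → Vec (m j))) (i : Fin N)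
    (h : Vec (m i)) :
    G.drift t (p + ownDir n m i h).1 (p + ownDir n m i h).2 =
      G.drift t p.1 p.2 + mulV (G.B t i) h := by
  have h1 : ∑ j, mulV (G.B t j) (Pi.single (M := fun j => Vec (m j)) i h j) =
      mulV (G.B t i) h := by
    rw [Finset.sum_eq_single i]
    · simp
    · intro j _ hj
      rw [Pi.single_eq_of_ne hj, mulV_zero]
    · simp
  simp only [drift, ownDir, ContinuousLinearMap.comp_apply, ContinuousLinearMap.inr_apply,
    ContinuousLinearMap.single_apply, Prod.fst_add, Prod.snd_add, Pi.add_apply, mulV_add,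
    Finset.sum_add_distrib, h1, mulV_zero]
  abel

/-- Along the line through her equilibrium control in direction `w`, the player's cost is a
quadratic polynomial minimal at `0`. -/
theorem OneShot.firstOrder {γ : DetProfile n m} {t : ℕ} (h : G.OneShot γ t) (ht : t < G.L)
    (i : Fin N) (hq : IsQuad (G.detQ γ i t)) (x : Vec n) (w : Vec (m i)) :
    slopeAlong (G.detQ γ i t) (x, fun j => γ j t x) (ownDir n m i w) = 0 ∧
      0 ≤ polarForm (G.detQ γ i t) (ownDir n m i w) (ownDir n m i w) := by
  have h1 := eq_zero_of_forall_quadratic_nonneg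
    (D := slopeAlong (G.detQ γ i t) (x, fun j => γ j t x) (ownDir n m i w))
    (b := polarForm (G.detQ γ i t) (ownDir n m i w) (ownDir n m i w) / 2) fun a => by
      have h2 := h x i (γ i t x + a • w)
      rw [mk_update_eq, G.detVal_eq_detQ γ i ht, add_sub_cancel_left, map_smul,
        hq.apply_add_smul] at h2
      linarith
  exact ⟨h1.1, by linarith [h1.2]⟩

/-- The first-order conditions of the static game at time `t` determine the controls. -/
def StaticRegular (G : LQGame N n z d s m) (γ : DetProfile n m) (t : ℕ) : Prop :=
  ∀ u : (j : Fin N) → Vec (m j),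
    (∀ i w, polarForm (G.detQ γ i t) (0, u) (ownDir n m i w) = 0) → u = 0

/-- The first-order conditions form a square linear system, with as many unknowns as equations, so
injectivity gives solvability. -/
theorem StaticRegular.exists_eq {γ : DetProfile n m} {t : ℕ} (h : G.StaticRegular γ t)
    (hq : ∀ i, IsQuad (G.detQ γ i t)) (φ : (i : Fin N) → Vec (m i) →ₗ[ℝ] ℝ) :
    ∃ u : (j : Fin N) → Vec (m j),
      ∀ i w, polarForm (G.detQ γ i t) (0, u) (ownDir n m i w) = φ i w := by
  choose B l c hB using hq
  let F : ((j : Fin N) → Vec (m j)) →ₗ[ℝ] ((i : Fin N) → Vec (m i) →ₗ[ℝ] ℝ) :=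
    LinearMap.pi fun i => LinearMap.mk₂ ℝ
      (fun u w => (B i + (B i).flip) (ContinuousLinearMap.inr ℝ (Vec n) _ u) (ownDir n m i w))
      (fun u u' w => by simp only [map_add, _root_.add_apply])
      (fun a u w => by simp only [map_smul, _root_.smul_apply])
      (fun u w w' => by simp only [map_add])
      (fun a u w => by simp only [map_smul])
  have hF : ∀ u i w, F u i w = polarForm (G.detQ γ i t) (0, u) (ownDir n m i w) := fun u i w => by
    rw [polarForm_eq (hB i)]
    rfl
  have hinj : Function.Injective F := by
    rw [injective_iff_map_eq_zero]
    exact fun u hu => h u fun i w => by rw [← hF, hu]; rfl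
  have hdim : Module.finrank ℝ ((j : Fin N) → Vec (m j)) =
      Module.finrank ℝ ((i : Fin N) → Vec (m i) →ₗ[ℝ] ℝ) := by
    rw [Module.finrank_pi_fintype, Module.finrank_pi_fintype]
    simp
  obtain ⟨u, hu⟩ := (LinearMap.injective_iff_surjective_of_finrank_eq_finrank hdim).1 hinj φ
  exact ⟨u, fun i w => by rw [← hF, hu]⟩

theorem detVal_congr {γ γ' : DetProfile n m} {t : ℕ} (h : ∀ j, ∀ t' ≥ t, γ j t' = γ' j t')
    (i : Fin N) : G.detVal γ i t = G.detVal γ' i t :=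
  funext fun x => G.detCost_congr i _ t h x

theorem OneShot.congr {γ γ' : DetProfile n m} {t : ℕ} (hγ : G.OneShot γ t)
    (h : ∀ j, ∀ t' ≥ t, γ j t' = γ' j t') : G.OneShot γ' t := fun x i w => by
  have h1 := hγ x i w
  rw [detQ, detVal_congr h, detVal_congr (t := t + 1) (fun j t' ht' => h j t' (by omega))] at h1
  simpa only [h _ t le_rfl] using! h1

/-- The profile `γ` shifted by controls that do not depend on the state. -/
def shift (γ : DetProfile n m) (c : ℕ → (j : Fin N) → Vec (m j)) : DetProfile n m :=
  fun j t x => γ j t x + c t j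

theorem shift_congr (γ : DetProfile n m) {c c' : ℕ → (j : Fin N) → Vec (m j)} {t : ℕ}
    (h : ∀ t' ≥ t, c t' = c' t') (j : Fin N) (t' : ℕ) (ht' : t' ≥ t) :
    shift γ c j t' = shift γ c' j t' := by
  funext x
  simp [shift, h t' ht']

theorem shift_eq_self (γ : DetProfile n m) {c : ℕ → (j : Fin N) → Vec (m j)} {t : ℕ}
    (h : ∀ t' ≥ t, c t' = 0) (j : Fin N) (t' : ℕ) (ht' : t' ≥ t) :
    shift γ c j t' = γ j t' := by
  funext x
  simp [shift, h t' ht']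

/-- If the value functions at time `t + 1` change by affine functions, then a constant shift of
the controls at time `t` that compensates the change preserves the equilibrium at time `t`, and
the value functions at time `t` change by affine functions. -/
theorem OneShot.shift {γ : DetProfile n m} (hγ : G.IsAffineProfile γ) {t : ℕ} (ht : t < G.L)
    (h : G.OneShot γ t) {c : ℕ → (j : Fin N) → Vec (m j)} {l : (i : Fin N) → Vec n →L[ℝ] ℝ}
    {b : Fin N → ℝ}
    (hl : ∀ i x, G.detVal (shift γ c) i (t + 1) x = G.detVal γ i (t + 1) x + (l i x + b i))
    (hc : ∀ i w, polarForm (G.detQ γ i t) (0, c t) (ownDir n m i w) =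
      -l i (mulV (G.B t i) w)) :
    G.OneShot (shift γ c) t ∧
      ∀ i, IsAff (fun x => G.detVal (LQGame.shift γ c) i t x - G.detVal γ i t x) := by
  have hQ : ∀ i p, G.detQ (LQGame.shift γ c) i t p =
      G.detQ γ i t p + (l i (G.drift t p.1 p.2) + b i) := fun i p => by
    rw [detQ, detQ, hl, add_assoc]
  have hpt : ∀ x, (x, fun j => LQGame.shift γ c j t x) =
      ((x, fun j => γ j t x) + (0, c t) : Vec n × ((j : Fin N) → Vec (m j))) := fun x => by
    refine Prod.ext (by simp) (funext fun j => rfl)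
  have hq := fun i => hγ.isQuad_detQ i ht
  constructor
  · intro x i w
    rw [detVal_eq_detQ _ _ _ ht, mk_update_eq, hQ, hQ, drift_add_ownDir, (hq i).apply_add, map_add]
    obtain ⟨h1, h2⟩ := h.firstOrder ht i (hq i) x (w - LQGame.shift γ c i t x)
    -- The slope at the shifted point is `-l i (mulV (G.B t i) w)` in a direction `w`, cancelling
    -- the new linear term; the second-order term left over is nonnegative.
    have h3 := (hq i).slopeAlong_add (x, fun j => γ j t x) (0, c t)
      (ownDir n m i (w - LQGame.shift γ c i t x))
    rw [h1, hc, ← hpt] at h3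
    linarith
  · intro i
    -- A constant shift leaves the part quadratic in `x` unchanged: the slope in a fixed direction
    -- is affine in the base point.
    have h1 : ∀ x, G.detVal (LQGame.shift γ c) i t x - G.detVal γ i t x =
        slopeAlong (G.detQ γ i t) (x, fun j => γ j t x) (0, c t) +
          (polarForm (G.detQ γ i t) (0, c t) (0, c t) / 2 + b i) +
          l i (G.drift t (x, fun j => LQGame.shift γ c j t x).1
            (x, fun j => LQGame.shift γ c j t x).2) := fun x => by
      rw [detVal_eq_detQ _ _ _ ht, detVal_eq_detQ _ _ _ ht, hQ, hpt, (hq i).apply_add]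
      ring
    rw [funext h1]
    refine (((hq i).isAff_slopeAlong _).comp (hγ.isAff_graph ht)).add (IsAff.const _) |>.add
      ((l i).isAff.comp ((G.isAff_drift t).comp ?_))
    simp only [hpt]
    exact (hγ.isAff_graph ht).add (IsAff.const _)

/-- If an affine feedback equilibrium is the only one, then its static games are regular. -/
theorem staticRegular_of_unique {γ : DetProfile n m} (hγ : G.IsAffineProfile γ)
    (hNash : G.IsDetFeedbackNash γ)
    (huniq : ∀ γ' : DetProfile n m, G.IsAffineProfile γ' → G.IsDetFeedbackNash γ' →
        ∀ i, ∀ k < G.L, ∀ x, γ' i k x = γ i k x) {t : ℕ} (ht : t < G.L) :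
    G.StaticRegular γ t := by
  induction t using Nat.strong_induction_on with
  | _ t ih =>
  intro u hu
  -- The shift is `u` at time `t` and zero later, and is extended backwards one time at a time; the
  -- regularity at earlier times comes from the strong induction.
  have key : ∀ r ≤ t, ∃ c : ℕ → (j : Fin N) → Vec (m j), c t = u ∧
      (∀ k, r ≤ k → k < G.L → G.OneShot (shift γ c) k) ∧
      ∀ i, IsAff (fun x => G.detVal (shift γ c) i r x - G.detVal γ i r x) := by
    intro r hr
    induction hr using Nat.decreasingInduction with
    | self =>
      let c : ℕ → (j : Fin N) → Vec (m j) := fun k => if k = t then u else 0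
      have hc0 : ∀ k ≥ t + 1, c k = 0 := fun k hk => if_neg (by omega)
      have hct : c t = u := if_pos rfl
      have h1 := (hNash.oneShot ht).shift hγ ht (c := c) (l := 0) (b := 0)
        (fun i x => by
          rw [detVal_congr (shift_eq_self γ hc0)]
          simp)
        (fun i w => by simpa [hct] using hu i w)
      refine ⟨c, hct, fun k hk hkL => ?_, h1.2⟩
      rcases hk.eq_or_lt with rfl | hk
      · exact h1.1
      · exact (hNash.oneShot hkL).congr fun j t' ht' =>
          (shift_eq_self γ hc0 j t' (by omega)).symm
    | of_succ r hr hstep =>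
      obtain ⟨c, hct, hos, haff⟩ := hstep
      choose l b hl using haff
      have hrL : r < G.L := by omega
      -- The shift `v` at time `r` compensates the linear change `l` of the next value functions.
      obtain ⟨v, hv⟩ := (ih r hr hrL).exists_eq (fun i => hγ.isQuad_detQ i hrL)
        (fun i => -((l i).comp (mulVL (G.B r i))).toLinearMap)
      have hc : ∀ k ≥ r + 1, Function.update c r v k = c k := fun k hk =>
        Function.update_of_ne (by omega) _ _
      have h1 := (hNash.oneShot hrL).shift hγ hrL (c := Function.update c r v) (l := l) (b := b)
        (fun i x => by
          rw [detVal_congr (shift_congr γ hc), ← hl i x]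
          ring)
        (fun i w => by simpa using! hv i w)
      refine ⟨Function.update c r v, by rw [hc t hr, hct], fun k hk hkL => ?_, h1.2⟩
      rcases hk.eq_or_lt with rfl | hk
      · exact h1.1
      · exact (hos k hk hkL).congr fun j t' ht' =>
          (shift_congr γ hc j t' (by omega)).symm
  obtain ⟨c, hct, hos, -⟩ := key 0 (Nat.zero_le t)
  have haff : G.IsAffineProfile (shift γ c) := fun i k hk => by
    obtain ⟨f, hf⟩ := hγ i k hk
    exact ⟨f + AffineMap.const ℝ _ (c k i), fun x => by simp [shift, hf]⟩
  have h1 := huniq _ haff (G.isDetFeedbackNash_of_oneShot fun k hk => hos k (Nat.zero_le k) hk)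
  funext i
  have h2 := h1 i t ht 0
  rw [shift, hct] at h2
  simpa using h2

end LQGame

namespace LQGame.NoiseModel

variable {N n z d s : ℕ} {m : Fin N → ℕ} {G : LQGame N n z d s m}
  {Ω : Type*} [MeasurableSpace Ω] {P : Measure Ω} {X : G.NoiseModel P}

/-! ### Uniqueness of the feedback equilibrium of the stochastic game -/

/-- The strategy of player `i` that moves her control at time `t` along `w`, by `a` times the
directional derivative of her remaining cost. -/
noncomputable def gradientStep (G : LQGame N n z d s m) (γ : DetProfile n m) (σ : Profile z m)
    (i : Fin N) (t : ℕ) (w : Vec (m i)) (a : ℝ) : Strategy z m i :=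
  fun k I => if k = t then σ i k I + (a * slopeAlong (G.detQ γ i k)
    (G.xhat k I, fun j => σ j k I) (ownDir n m i w)) • w else σ i k I

theorem gradientStep_self (γ : DetProfile n m) (σ : Profile z m) (i : Fin N) (t : ℕ)
    (w : Vec (m i)) (a : ℝ) (I : History z m t) :
    gradientStep G γ σ i t w a t I = σ i t I + (a * slopeAlong (G.detQ γ i t)
      (G.xhat t I, fun j => σ j t I) (ownDir n m i w)) • w := if_pos rfl

theorem gradientStep_of_ne (γ : DetProfile n m) (σ : Profile z m) (i : Fin N) {t k : ℕ}
    (hk : k ≠ t) (w : Vec (m i)) (a : ℝ) : gradientStep G γ σ i t w a k = σ i k :=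
  funext fun _ => if_neg hk

section

variable {γ : DetProfile n m} {σ τ : Profile z m} {t : ℕ}

theorem control_gradientStep (i : Fin N) (w : Vec (m i)) (a : ℝ) (ω : Ω) :
    X.control (splice t τ (Function.update σ i (gradientStep G γ σ i t w a))) i t ω =
      X.control (splice t τ σ) i t ω + (a * slopeAlong (G.detQ γ i t)
        (X.estCtrl (splice t τ σ) t ω) (ownDir n m i w)) • w := by
  have hI : X.info (splice t τ (Function.update σ i (gradientStep G γ σ i t w a))) t =
      X.info (splice t τ σ) t :=
    X.info_congr fun j t' ht' => by rw [splice_of_lt ht', splice_of_lt ht']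
  simp only [control, estCtrl, estimate, hI, splice_of_le le_rfl, Function.update_self,
    gradientStep_self]

theorem control_gradientStep_of_ne {i j : Fin N} (hj : j ≠ i) (w : Vec (m i)) (a : ℝ) :
    X.control (splice t τ (Function.update σ i (gradientStep G γ σ i t w a))) j t =
      X.control (splice t τ σ) j t := by
  have hI : X.info (splice t τ (Function.update σ i (gradientStep G γ σ i t w a))) t =
      X.info (splice t τ σ) t :=
    X.info_congr fun j t' ht' => by rw [splice_of_lt ht', splice_of_lt ht']
  funext ω
  simp only [control, hI, splice_of_le le_rfl, Function.update_of_ne hj]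

theorem estCtrl_gradientStep (i : Fin N) (w : Vec (m i)) (a : ℝ) (ω : Ω) :
    X.estCtrl (splice t τ (Function.update σ i (gradientStep G γ σ i t w a))) t ω =
      X.estCtrl (splice t τ σ) t ω + (a * slopeAlong (G.detQ γ i t)
        (X.estCtrl (splice t τ σ) t ω) (ownDir n m i w)) • ownDir n m i w := by
  have hI : X.info (splice t τ (Function.update σ i (gradientStep G γ σ i t w a))) t =
      X.info (splice t τ σ) t :=
    X.info_congr fun j t' ht' => by rw [splice_of_lt ht', splice_of_lt ht']
  rw [← map_smul]
  refine Prod.ext ?_ (funext fun j => ?_)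
  · simp [estCtrl, estimate, hI, ownDir]
  · by_cases hj : j = i
    · subst hj
      have := X.control_gradientStep (γ := γ) (σ := σ) (τ := τ) (t := t) j w a ω
      simpa [estCtrl, ownDir] using! this
    · simp [estCtrl, ownDir, X.control_gradientStep_of_ne hj, Pi.single_eq_of_ne hj]

variable [IsProbabilityMeasure P]

theorem admissible_gradientStep (hγ : G.IsAffineProfile γ) (hσ : X.IsFeedbackNash σ)
    (hτ : X.Admissible τ) (ht : t < G.L) (i : Fin N) (w : Vec (m i)) (a : ℝ) :
    X.Admissible (splice t τ (Function.update σ i (gradientStep G γ σ i t w a))) := by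
  set ρ' := splice t τ (Function.update σ i (gradientStep G γ σ i t w a)) with hρ'
  have hρ := (hσ τ hτ t ht.le).1
  have haff := (hγ.isQuad_detQ i ht).isAff_slopeAlong (ownDir n m i w)
  have h1 : ∀ j, ∀ k < G.L, k < t + 1 → Measurable (ρ' j k) ∧ MemLp (X.control ρ' j k) 2 P := by
    intro j k hk hkt
    rcases (Nat.lt_succ_iff.1 hkt).eq_or_lt with rfl | hkt
    · by_cases hj : j = i
      · subst hj
        constructor
        · have h2 : ∀ j, Measurable (σ j k) := fun j => by
            have := (hρ j k hk).1
            rwa [splice_of_le le_rfl] at this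
          have h3 := haff.continuous.measurable.comp ((G.measurable_xhat k).prodMk
            (measurable_pi_lambda _ h2))
          have h4 : ρ' j k = fun I => σ j k I + (a * slopeAlong (G.detQ γ j k)
              (G.xhat k I, fun j => σ j k I) (ownDir n m j w)) • w := by
            rw [hρ', splice_of_le le_rfl, Function.update_self]
            exact funext fun I => gradientStep_self γ σ j k w a I
          rw [h4]
          exact (h2 j).add ((h3.const_mul a).smul_const w)
        · have h2 := ((haff.memLp (hρ.memLp_estCtrl hk)).const_mul a).continuousLinearMap_comp
            (ContinuousLinearMap.toSpanSingleton ℝ w)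
          exact (memLp_congr_ae (.of_forall fun ω => X.control_gradientStep j w a ω)).2
            ((hρ j k hk).2.add h2)
      · rw [hρ', splice_of_le le_rfl, Function.update_of_ne hj, X.control_gradientStep_of_ne hj]
        have h2 := hρ j k hk
        rwa [splice_of_le le_rfl] at h2
    · rw [hρ', splice_of_lt hkt, X.control_congr (σ' := τ) fun j t' ht' =>
        splice_of_lt (by omega) τ _ j]
      exact hτ j k hk
  -- After time `t` the deviation follows `σ`, whose admissibility is granted only after an
  -- admissible past. The deviation up to `t`, continued by `γ`, is such a past.
  have h2 := (hσ _ (admissible_splice_atEstimate hγ h1) (t + 1) ht).1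
  have h3 : splice (t + 1) (splice (t + 1) ρ' (G.atEstimate γ)) σ = ρ' := by
    funext j k
    by_cases hk : k < t + 1
    · rw [splice_of_lt hk, splice_of_lt hk]
    · rw [splice_of_le (not_lt.1 hk), hρ', splice_of_le (by omega)]
      by_cases hj : j = i
      · subst hj
        rw [Function.update_self, gradientStep_of_ne _ _ _ (by omega)]
      · rw [Function.update_of_ne hj]
  rwa [h3] at h2

/-- The deviation is proportional to the slope `D` itself, so that its first-order effect is a
multiple of the mean of `D ^ 2`. The assumption `hlate` covers all admissible profiles because it is
also applied to the deviated play. -/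
theorem slopeAlong_ae_eq_zero (hK : G.KalmanWellPosed) (hγ : G.IsAffineProfile γ)
    (hσ : X.IsFeedbackNash σ) (hτ : X.Admissible τ) (ht : t < G.L)
    (hlate : ∀ ρ : Profile z m, X.Admissible ρ → ∀ k, t < k → k < G.L → ∀ j, ∀ᵐ ω ∂P,
      σ j k (X.info ρ k ω) = γ j k (X.estimate ρ k ω)) (i : Fin N) (w : Vec (m i)) :
    ∀ᵐ ω ∂P, slopeAlong (G.detQ γ i t) (X.estCtrl (splice t τ σ) t ω) (ownDir n m i w) = 0 := by
  have hρ := (hσ τ hτ t ht.le).1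
  set ρ := splice t τ σ with hρdef
  have hq := hγ.isQuad_detQ i ht
  let D : Ω → ℝ := fun ω => slopeAlong (G.detQ γ i t) (X.estCtrl ρ t ω) (ownDir n m i w)
  have hD : MemLp D 2 P := (hq.isAff_slopeAlong _).memLp (hρ.memLp_estCtrl ht)
  have hD2 : Integrable (fun ω => D ω ^ 2) P := hD.integrable_sq
  let κ : ℝ := polarForm (G.detQ γ i t) (ownDir n m i w) (ownDir n m i w)
  obtain ⟨C, hC⟩ := X.exists_cost_eq_add_sum_gap hK hγ i
  have key : ∀ a : ℝ, 0 ≤ a * ∫ ω, D ω ^ 2 ∂P + a ^ 2 * (κ / 2 * ∫ ω, D ω ^ 2 ∂P) := by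
    intro a
    have hρ' := admissible_gradientStep hγ hσ hτ ht i w a
    have hcost := (hσ τ hτ t ht.le).2 i _ hρ'
    rw [← hρdef, hC _ hρ, hC _ hρ'] at hcost
    set ρ' := splice t τ (Function.update σ i (gradientStep G γ σ i t w a)) with hρdef'
    have hestCtrl : ∀ ω, X.estCtrl ρ' t ω = X.estCtrl ρ t ω + (a * D ω) • ownDir n m i w :=
      fun ω => X.estCtrl_gradientStep i w a ω
    have hest : X.estimate ρ' t = X.estimate ρ t := by
      unfold estimate
      rw [X.info_congr (σ := ρ') (σ' := ρ) fun j t' ht' => by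
        rw [hρdef, hρdef', splice_of_lt ht', splice_of_lt ht']]
    -- Before `t` both profiles coincide; after `t` both follow `σ`, which agrees with `γ` almost
    -- surely, so their gaps vanish.
    have hsum : ∑ k ∈ Finset.range G.L, (X.gap γ ρ' i k - X.gap γ ρ i k) =
        X.gap γ ρ' i t - X.gap γ ρ i t := by
      refine Finset.sum_eq_single t (fun k hk hkt => sub_eq_zero.2 ?_)
        (fun h => absurd (Finset.mem_range.2 ht) h)
      have hk := Finset.mem_range.1 hk
      rcases lt_or_gt_of_ne hkt with hkt | hkt
      · refine gap_congr (fun j t' ht' => ?_) i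
        rw [hρdef, hρdef', splice_of_lt (by omega), splice_of_lt (by omega)]
      · rw [gap_eq_zero hk, gap_eq_zero hk]
        · intro j
          filter_upwards [hlate ρ hρ k hkt hk j] with ω hω
          rw [← hω, control, hρdef, splice_of_le hkt.le]
        · intro j
          filter_upwards [hlate ρ' hρ' k hkt hk j] with ω hω
          rw [← hω, control, hρdef', splice_of_le hkt.le]
          by_cases hj : j = i
          · subst hj
            rw [Function.update_self, gradientStep_of_ne _ _ _ (by omega)]
          · rw [Function.update_of_ne hj]
    rw [Finset.sum_sub_distrib] at hsum
    have h1 : ∫ ω, G.detQ γ i t (X.estCtrl ρ' t ω) ∂P = ∫ ω, G.detQ γ i t (X.estCtrl ρ t ω) ∂P +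
        (a * ∫ ω, D ω ^ 2 ∂P + a ^ 2 * (κ / 2 * ∫ ω, D ω ^ 2 ∂P)) := by
      -- The exact second-order expansion with step `a * D ω` has first-order term `a * D ω * D ω`,
      -- so both terms are multiples of `D ω ^ 2`.
      have h2 : ∀ ω, G.detQ γ i t (X.estCtrl ρ' t ω) = G.detQ γ i t (X.estCtrl ρ t ω) +
          (a + a ^ 2 * (κ / 2)) * D ω ^ 2 := fun ω => by
        rw [hestCtrl, hq.apply_add_smul]
        simp only [D, κ]
        ring
      simp only [h2]
      rw [integral_add (hq.integrable (hρ.memLp_estCtrl ht)) (hD2.const_mul _),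
        integral_const_mul]
      ring
    have h3 := hρ.gap_eq hγ i ht
    have h4 := hρ'.gap_eq hγ i ht
    rw [hest, h1] at h4
    linarith
  have hzero := (eq_zero_of_forall_quadratic_nonneg key).1
  rw [integral_eq_zero_iff_of_nonneg (fun ω => sq_nonneg (D ω)) hD2] at hzero
  filter_upwards [hzero] with ω hω
  simpa using hω

theorem control_ae_eq (hK : G.KalmanWellPosed) (hγ : G.IsAffineProfile γ)
    (hNash : G.IsDetFeedbackNash γ) (hreg : ∀ k < G.L, G.StaticRegular γ k)
    (hσ : X.IsFeedbackNash σ) (ht : t < G.L) (hτ : X.Admissible τ) (j : Fin N) :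
    ∀ᵐ ω ∂P, σ j t (X.info τ t ω) = γ j t (X.estimate τ t ω) := by
  have key : ∀ r k, k < G.L → G.L ≤ k + r → ∀ ρ : Profile z m, X.Admissible ρ → ∀ j,
      ∀ᵐ ω ∂P, σ j k (X.info ρ k ω) = γ j k (X.estimate ρ k ω) := by
    intro r
    induction r with
    | zero => exact fun k hk hkr => absurd hk (by omega)
    | succ r ih =>
      intro k hk hkr ρ hρ j
      -- Finitely many basis directions leave a single null set; linearity of the slope then covers
      -- every `w`.
      have hslope : ∀ᵐ ω ∂P, ∀ (i : Fin N) (b : Fin (m i)), slopeAlong (G.detQ γ i k)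
          (X.estCtrl (splice k ρ σ) k ω)
          (ownDir n m i ((EuclideanSpace.basisFun (Fin (m i)) ℝ).toBasis b)) = 0 :=
        ae_all_iff.2 fun i => ae_all_iff.2 fun b => slopeAlong_ae_eq_zero hK hγ hσ hρ hk
          (fun ρ' hρ' k' hkk' hk' j => ih k' hk' (by omega) ρ' hρ' j) i _
      filter_upwards [hslope] with ω hω
      have hI : X.info (splice k ρ σ) k = X.info ρ k :=
        X.info_congr fun j t' ht' => splice_of_lt ht' ρ σ j
      have hp : X.estCtrl (splice k ρ σ) k ω =
          (X.estimate ρ k ω, fun j => γ j k (X.estimate ρ k ω)) +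
            (0, fun j => σ j k (X.info ρ k ω) - γ j k (X.estimate ρ k ω)) := by
        simp [estCtrl, estimate, control, hI, splice_of_le le_rfl, ← Pi.sub_def]
      -- Both `σ` and `γ` satisfy the first-order conditions at the same estimate, so their
      -- difference solves the homogeneous ones.
      have h0 := hreg k hk (fun j => σ j k (X.info ρ k ω) - γ j k (X.estimate ρ k ω))
        fun i w => by
          have hq := hγ.isQuad_detQ i hk
          obtain ⟨S, hS⟩ := hq.exists_slopeAlong_eq (X.estCtrl (splice k ρ σ) k ω)
          have h1 : (S.comp (ownDir n m i)).toLinearMap = 0 :=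
            (EuclideanSpace.basisFun (Fin (m i)) ℝ).toBasis.ext fun b => by
              exact (hS _).symm.trans (hω i b)
          have h2 : S (ownDir n m i w) = 0 := LinearMap.congr_fun h1 w
          rw [← hS, hp, hq.slopeAlong_add, ((hNash.oneShot hk).firstOrder hk i hq _ w).1,
            zero_add] at h2
          exact h2
      exact sub_eq_zero.1 (congrFun h0 j)
  exact key G.L t ht (by omega) τ hτ j

end

end LQGame.NoiseModel

theorem theorem1 {N n z d s : ℕ} {m : Fin N → ℕ} (G : LQGame N n z d s m)
    {Ω : Type*} [MeasurableSpace Ω] (P : Measure Ω) [IsProbabilityMeasure P]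
    (X : G.NoiseModel P) (hK : G.KalmanWellPosed)
    (γ : LQGame.DetProfile n m) (hγ : G.IsAffineProfile γ) (hNash : G.IsDetFeedbackNash γ) :
    X.IsNash (G.atEstimate γ) ∧
    X.IsFeedbackNash (G.atEstimate γ) ∧
    ((∀ γ' : LQGame.DetProfile n m, G.IsAffineProfile γ' → G.IsDetFeedbackNash γ' →
        ∀ i, ∀ k < G.L, ∀ x, γ' i k x = γ i k x) →
      ∀ σ : LQGame.Profile z m, X.IsFeedbackNash σ →
        ∀ τ : LQGame.Profile z m, X.Admissible τ →
          ∀ i, ∀ k < G.L, ∀ᵐ ω ∂P,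
            σ i k (X.info τ k ω) = γ i k (G.xhat k (X.info τ k ω))) := by
  have hF : X.IsFeedbackNash (G.atEstimate γ) :=
    LQGame.NoiseModel.isFeedbackNash_atEstimate hK hγ hNash
  refine ⟨hF.isNash, hF, fun huniq σ hσ τ hτ i k hk => ?_⟩
  exact LQGame.NoiseModel.control_ae_eq hK hγ hNash
    (fun t ht => LQGame.staticRegular_of_unique hγ hNash huniq ht) hσ hk hτ i
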